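/- Let $\mathbb T=\{t\in\mathbb C:|t|=1\}$ and $1<p<\infty$. Let $L^p=L^p(\mathbb T)$ (with respect to arc length), let $\widehat f_n$ ($n\in\mathbb Z$) denote the Fourier coefficients of $f$, and let $H^p=\{f\in L^p:\widehat f_n=0\text{ for all }n<0\}$. Let $P:L^p\to L^p$, $\sum_{n\in\mathbb Z}\widehat f_nt^n\mapsto\sum_{n\ge 0}\widehat f_nt^n$, be the (bounded) Riesz projection onto $H^p$ and $Q=I-P$. Let $\beta\in\mathbb C$ with $|\beta|>1$, and put $$\alpha(t)=\frac{t-\beta}{\overline\beta t-1},\qquad \lambda=i\sqrt{|\beta|^2-1},\qquad \alpha_-(t)=\frac{\lambda t}{\overline\beta t-1},\qquad \chi(t)=\frac{t}{\alpha_-(t)}\qquad(t\in\mathbb T),$$ so that $\alpha$ maps $\mathbb T$ onto itself, and let $J_\alpha$ be the bounded operator on $L^p$ given by $J_\alpha\varphi(t)=t^{-1}\alpha_-(t)\varphi(\alpha(t))$. For $a,b\in L^\infty=L^\infty(\mathbb T)$ define bounded operators on $H^p$ by $T(a)\varphi=P(a\varphi)$ and $H_\alpha(b)\varphi=P(b\,QJ_\alpha\varphi)$.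 For a bounded operator $A$ on $H^p$ with Banach space adjoint $A^*$ on the dual space $(H^p)^*$, let $\operatorname{coker}A=\{x\in(H^p)^*:A^*x=0\}$. Theorem. Let $a$ be an invertible element of the algebra $L^\infty$, and let $A$ be any of the four operators $$T(a)-H_\alpha(a\chi^{-1}),\qquad T(a)+H_\alpha(a\chi),\qquad T(a)+H_\alpha(a),\qquad T(a)-H_\alpha(a)$$ on $H^p$. Then $\ker A=\{0\}$ or $\operatorname{coker}A=\{0\}$. -/

import Mathlib

open MeasureTheory Complex
open scoped ENNReal ComplexConjugate

noncomputable section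

namespace GenHankel

/-! ## The unit circle, `L^p`, `L^∞`, Hardy spaces -/

/-- The unit circle `𝕋 = {t : |t| = 1}`, parametrized by `θ ∈ ℝ/ℤ` through `t = e^{2πiθ}`. -/
abbrev Torus : Type := AddCircle (1 : ℝ)

/-- The point `t = e^{2πiθ}` of `ℂ` with parameter `θ`. -/
def pt (θ : Torus) : ℂ := (AddCircle.toCircle θ : ℂ)

/-- Normalized arc length `|dt| / 2π`. -/
abbrev arc : Measure Torus := AddCircle.haarAddCircle

/-- `L^p(𝕋)`. -/
abbrev LpT (p : ℝ≥0∞) : Type := Lp ℂ p arc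

/-- `L^∞(𝕋)`. -/
abbrev Linf : Type := LpT ∞

/-- The pointwise product of two functions of `L^∞`. -/
def mulInf (a b : Linf) : Linf := (ContinuousLinearMap.mul ℂ ℂ).holder ∞ a b

/-- `a ∈ GL^∞`: `a` is invertible in the algebra `L^∞`. -/
def IsGLinf (a : Linf) : Prop := ∃ b : Linf, ∀ᵐ θ ∂arc, a θ * b θ = 1

/-- A continuous function on `𝕋` as an element of `L^∞`. -/
def ofCont (f : C(Torus, ℂ)) : Linf := ContinuousMap.toLp ∞ arc ℂ f

variable (p : ℝ≥0∞) [Fact (1 ≤ p)]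

/-- The operator of multiplication by `a ∈ L^∞` on `L^p`. -/
def mulOp (a : Linf) : LpT p →L[ℂ] LpT p :=
  (ContinuousLinearMap.mul ℂ ℂ).holderL arc ∞ p p a

lemma integrable_coe (f : LpT p) : Integrable f arc :=
  (Lp.memLp f).integrable Fact.out

/-- The Hardy space `H^p = {f ∈ L^p : f̂_n = 0 for all n < 0}`, with the norm of `L^p`. -/
def Hardy : Submodule ℂ (LpT p) where
  carrier := {f | ∀ n : ℤ, n < 0 → fourierCoeff f n = 0}
  zero_mem' n _ := by
    rw [fourierCoeff_congr_ae (Lp.coeFn_zero ℂ p arc)]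
    simp [fourierCoeff]
  add_mem' {f g} hf hg n hn := by
    rw [fourierCoeff_congr_ae (Lp.coeFn_add f g),
      fourierCoeff.add (integrable_coe p f) (integrable_coe p g), Pi.add_apply, hf n hn, hg n hn,
      add_zero]
  smul_mem' c f hf n hn := by
    rw [fourierCoeff_congr_ae (Lp.coeFn_smul c f), fourierCoeff.const_smul, hf n hn, smul_zero]

open Classical in
/-- The Riesz projection `P : ∑_{n ∈ ℤ} f̂_n tⁿ ↦ ∑_{n ≥ 0} f̂_n tⁿ` on `L^p`: the bounded operator
with `(P f)^_n = f̂_n` for `n ≥ 0` and `(P f)^_n = 0` for `n < 0`. There is at most one such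
operator because a function is determined by its Fourier coefficients, and for `1 < p < ∞` there is
one by the theorem of M. Riesz; the value `0` only serves `p = 1` and `p = ∞`, where there is
none. -/
def rieszP : LpT p →L[ℂ] LpT p :=
  if h : ∃ P : LpT p →L[ℂ] LpT p, ∀ (f : LpT p) (n : ℤ),
      fourierCoeff (P f) n = if 0 ≤ n then fourierCoeff f n else 0
  then h.choose else 0

/-- The complementary projection `Q = I - P`. -/
def rieszQ : LpT p →L[ℂ] LpT p := ContinuousLinearMap.id ℂ (LpT p) - rieszP p

lemma rieszP_mem (f : LpT p) : rieszP p f ∈ Hardy p := by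
  rw [rieszP]
  split_ifs with h
  · intro n hn
    rw [h.choose_spec f n, if_neg (not_le.2 hn)]
  · exact (Hardy p).zero_mem

/-- The Riesz projection as an operator from `L^p` to `H^p`. -/
def rieszPH : LpT p →L[ℂ] Hardy p := (rieszP p).codRestrict (Hardy p) (rieszP_mem p)

/-! ## The shift -/

/-- `α(z) = (z - β) / (β̄ z - 1)`. -/
def alpha (β z : ℂ) : ℂ := (z - β) / (conj β * z - 1)

/-- `λ = i √(|β|² - 1)`. -/
def lam (β : ℂ) : ℂ := I * (Real.sqrt (‖β‖ ^ 2 - 1) : ℂ)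

/-- `α₋(t) = λ t / (β̄ t - 1)`. -/
def alphaMinus (β t : ℂ) : ℂ := lam β * t / (conj β * t - 1)

/-- `χ(t) = t / α₋(t)`. -/
def chiFun (β t : ℂ) : ℂ := t / alphaMinus β t

lemma norm_pt (θ : Torus) : ‖pt θ‖ = 1 := Circle.norm_coe _

lemma pt_ne_zero (θ : Torus) : pt θ ≠ 0 := Circle.coe_ne_zero _

lemma continuous_pt : Continuous pt :=
  continuous_subtype_val.comp AddCircle.continuous_toCircle

lemma lam_ne_zero {β : ℂ} (hβ : 1 < ‖β‖) : lam β ≠ 0 := by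
  have : (0 : ℝ) < ‖β‖ ^ 2 - 1 := by nlinarith
  exact mul_ne_zero I_ne_zero (ofReal_ne_zero.2 (Real.sqrt_pos.2 this).ne')

lemma le_norm_den {β z : ℂ} (hz : ‖z‖ = 1) : ‖β‖ - 1 ≤ ‖conj β * z - 1‖ := by
  have h := norm_sub_norm_le (conj β * z) 1
  simpa [hz] using h

lemma den_ne_zero {β z : ℂ} (hβ : 1 < ‖β‖) (hz : ‖z‖ = 1) : conj β * z - 1 ≠ 0 := by
  have h := le_norm_den (β := β) hz
  exact norm_pos_iff.1 (by linarith)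

lemma norm_alpha {β z : ℂ} (hβ : 1 < ‖β‖) (hz : ‖z‖ = 1) : ‖alpha β z‖ = 1 := by
  have h0 := den_ne_zero hβ hz
  have hzz : z * conj z = 1 := by rw [mul_conj, normSq_eq_norm_sq, hz]; norm_num
  have h1 : ‖z - β‖ = ‖conj β * z - 1‖ := by
    have : conj β * z - 1 = - (z * conj (z - β)) := by
      rw [map_sub, mul_sub, hzz]; ring
    rw [this, norm_neg, norm_mul, hz, one_mul, norm_conj]
  rw [alpha, norm_div, h1, div_self (norm_ne_zero_iff.2 h0)]

lemma alpha_alpha {β z : ℂ} (hβ : 1 < ‖β‖) (hz : ‖z‖ = 1) : alpha β (alpha β z) = z := by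
  have h0 := den_ne_zero hβ hz
  have h1 := den_ne_zero hβ (norm_alpha hβ hz)
  rw [alpha, div_eq_iff h1]
  have h3 : alpha β z * (conj β * z - 1) = z - β := div_mul_cancel₀ _ h0
  linear_combination -h3

variable (β : ℂ)

/-- The shift `α : 𝕋 → 𝕋` in the parameter `θ`. -/
def shift (hβ : 1 < ‖β‖) (θ : Torus) : Torus :=
  (AddCircle.homeomorphCircle one_ne_zero).symm
    ⟨alpha β (pt θ), mem_sphere_zero_iff_norm.2 (norm_alpha hβ (norm_pt θ))⟩

lemma pt_shift (hβ : 1 < ‖β‖) (θ : Torus) : pt (shift β hβ θ) = alpha β (pt θ) := by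
  have h := (AddCircle.homeomorphCircle one_ne_zero).apply_symm_apply
    (⟨alpha β (pt θ), mem_sphere_zero_iff_norm.2 (norm_alpha hβ (norm_pt θ))⟩ : Circle)
  rw [AddCircle.homeomorphCircle_apply] at h
  exact congrArg Subtype.val h

lemma pt_injective : Function.Injective pt := fun _ _ h =>
  AddCircle.injective_toCircle one_ne_zero (Circle.ext h)

lemma shift_shift (hβ : 1 < ‖β‖) (θ : Torus) : shift β hβ (shift β hβ θ) = θ :=
  pt_injective (by rw [pt_shift, pt_shift, alpha_alpha hβ (norm_pt θ)])

lemma continuous_alpha_pt (hβ : 1 < ‖β‖) : Continuous fun θ : Torus => alpha β (pt θ) :=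
  (continuous_pt.sub continuous_const).div
    ((continuous_const.mul continuous_pt).sub continuous_const)
    fun θ => den_ne_zero hβ (norm_pt θ)

lemma continuous_shift (hβ : 1 < ‖β‖) : Continuous (shift β hβ) :=
  (Homeomorph.continuous _).comp ((continuous_alpha_pt β hβ).subtype_mk _)

lemma pt_coe (x : ℝ) : pt (x : Torus) = exp (2 * Real.pi * x * I) := by
  rw [pt, AddCircle.toCircle_apply_mk, Circle.coe_exp]
  push_cast
  simp

/-- A constant that bounds the derivative of `α` on `𝕋`. -/
def shiftConst : ℝ := (‖β‖ ^ 2 - 1) / (‖β‖ - 1) ^ 2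

lemma arc_eq_volume : arc = (volume : Measure Torus) := by
  rw [AddCircle.volume_eq_smul_haarAddCircle, ENNReal.ofReal_one, one_smul]

lemma hasDerivAt_lift (hβ : 1 < ‖β‖) (x : ℝ) (hx : alpha β (pt (x : Torus)) ∈ slitPlane) :
    ∃ d : ℝ, |d| ≤ shiftConst β ∧
      HasDerivAt (fun y : ℝ => arg (alpha β (pt (y : Torus))) / (2 * Real.pi)) d x := by
  set z : ℂ := pt (x : Torus) with hz
  have hz1 : ‖z‖ = 1 := norm_pt _
  have h0 := den_ne_zero hβ hz1
  have e1 : HasDerivAt (fun y : ℝ => pt (y : Torus)) (z * (2 * Real.pi * I)) x := by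
    have h : HasDerivAt (fun y : ℝ => (2 * Real.pi * y * I : ℂ)) (2 * Real.pi * I) x := by
      have := ((hasDerivAt_id x).ofReal_comp.const_mul (2 * Real.pi : ℂ)).mul_const I
      simpa using this
    have h' := h.cexp
    simp only [← pt_coe] at h'
    exact h'
  have e2 : HasDerivAt (fun y : ℝ => alpha β (pt (y : Torus)))
      (((z * (2 * Real.pi * I)) * (conj β * z - 1) -
        (z - β) * (conj β * (z * (2 * Real.pi * I)))) / (conj β * z - 1) ^ 2) x :=
    (e1.sub_const β).div ((e1.const_mul (conj β)).sub_const 1) h0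
  have e3 : HasDerivAt (fun y : ℝ => arg (alpha β (pt (y : Torus))) / (2 * Real.pi))
      ((((z * (2 * Real.pi * I)) * (conj β * z - 1) -
        (z - β) * (conj β * (z * (2 * Real.pi * I)))) / (conj β * z - 1) ^ 2 /
        alpha β z).im / (2 * Real.pi)) x := by
    have h := (imCLM.hasFDerivAt.comp_hasDerivAt x (e2.clog_real hx)).div_const (2 * Real.pi)
    have hl : (fun y : ℝ => arg (alpha β (pt (y : Torus))) / (2 * Real.pi)) =
        fun y : ℝ => (imCLM ∘ fun t : ℝ => log (alpha β (pt (t : Torus)))) y / (2 * Real.pi) := by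
      funext y
      simp [log_im]
    rw [hl]
    exact h
  refine ⟨_, ?_, e3⟩
  have hpi : (0 : ℝ) < 2 * Real.pi := by positivity
  rw [abs_div, abs_of_pos hpi, div_le_iff₀ hpi]
  refine (abs_im_le_norm _).trans ?_
  rw [norm_div, norm_alpha hβ hz1, div_one]
  have e4 : (z * (2 * Real.pi * I)) * (conj β * z - 1) -
        (z - β) * (conj β * (z * (2 * Real.pi * I))) =
      (z * (2 * Real.pi * I)) * ((‖β‖ ^ 2 - 1 : ℝ) : ℂ) := by
    have : ((‖β‖ ^ 2 - 1 : ℝ) : ℂ) = β * conj β - 1 := by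
      rw [mul_conj, normSq_eq_norm_sq]; push_cast; rfl
    rw [this]; ring
  have hb : (0 : ℝ) ≤ ‖β‖ ^ 2 - 1 := by nlinarith
  have e5 : ‖z * (2 * Real.pi * I)‖ = 2 * Real.pi := by
    rw [norm_mul, hz1, norm_mul, norm_I]
    simp [abs_of_pos Real.pi_pos]
  rw [e4, norm_div, norm_mul, e5, norm_real, Real.norm_of_nonneg hb, norm_pow, shiftConst,
    mul_comm, mul_div_right_comm]
  have h1 : 0 < ‖β‖ - 1 := by linarith
  have h2 := le_norm_den (β := β) hz1
  gcongr

lemma arc_apply (t : ℝ) {s : Set Torus} (hs : MeasurableSet s) :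
    arc s = volume (((↑) : ℝ → Torus) ⁻¹' s ∩ Set.Ioc t (t + 1)) := by
  rw [arc_eq_volume, ← (AddCircle.measurePreserving_mk 1 t).map_eq,
    Measure.map_apply AddCircle.measurable_mk' hs,
    Measure.restrict_apply (AddCircle.measurable_mk' hs)]

lemma map_shift_le (hβ : 1 < ‖β‖) :
    Measure.map (shift β hβ) arc ≤ ENNReal.ofReal (shiftConst β) • arc := by
  refine Measure.le_iff.2 fun s hs => ?_
  have hm := (continuous_shift β hβ).measurable
  have hmk : Measurable ((↑) : ℝ → Torus) := AddCircle.measurable_mk'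
  rw [Measure.map_apply hm hs, Measure.smul_apply, smul_eq_mul, arc_apply (-(1 / 2)) (hm hs),
    arc_apply 0 hs]
  set f : ℝ → ℝ := fun y => arg (alpha β (pt (y : Torus))) / (2 * Real.pi) with hf
  set E : Set ℝ := (((↑) : ℝ → Torus) ⁻¹' s ∩ Set.Ioc 0 (0 + 1)) ∩
    {y : ℝ | alpha β (pt (y : Torus)) ∈ slitPlane} with hE
  have hEm : MeasurableSet E := by
    refine ((hmk hs).inter measurableSet_Ioc).inter ?_
    exact (isOpen_slitPlane.preimage
      ((continuous_alpha_pt β hβ).comp (AddCircle.continuous_mk' 1))).measurableSet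
  have hd : ∀ x : ℝ, ∃ d : ℝ, x ∈ E → |d| ≤ shiftConst β ∧ HasDerivAt f d x := fun x => by
    by_cases hx : x ∈ E
    · obtain ⟨d, hd⟩ := hasDerivAt_lift β hβ x hx.2
      exact ⟨d, fun _ => hd⟩
    · exact ⟨0, fun h => absurd h hx⟩
  choose d hd using hd
  have hcov : ((↑) : ℝ → Torus) ⁻¹' (shift β hβ ⁻¹' s) ∩ Set.Ioo (-(1 / 2)) (-(1 / 2) + 1) ⊆
      f '' E := by
    rintro y ⟨hy, hy1, hy2⟩
    obtain ⟨x, hx, hxy⟩ : ∃ x ∈ Set.Ioc (0 : ℝ) (0 + 1), (x : Torus) = shift β hβ (y : Torus) := by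
      have := AddCircle.coe_image_Ioc_eq (1 : ℝ) 0
      have h' : shift β hβ (y : Torus) ∈ ((↑) : ℝ → Torus) '' Set.Ioc (0 : ℝ) (0 + 1) := by
        rw [this]; exact Set.mem_univ _
      exact h'
    have hpi := Real.pi_pos
    have ha : alpha β (pt (x : Torus)) = exp ((2 * Real.pi * y : ℝ) * I) := by
      rw [hxy, pt_shift, alpha_alpha hβ (norm_pt _), pt_coe]
      push_cast
      rfl
    have hmem : 2 * Real.pi * y ∈ Set.Ioo (-Real.pi) Real.pi := by
      constructor <;> nlinarith
    have harg : arg (alpha β (pt (x : Torus))) = 2 * Real.pi * y := by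
      rw [ha, arg_exp_mul_I, toIocMod_eq_self]
      exact ⟨hmem.1, by linarith [hmem.2]⟩
    refine ⟨x, ⟨⟨?_, hx⟩, ?_⟩, ?_⟩
    · rw [Set.mem_preimage, hxy]; exact hy
    · rw [Set.mem_ofPred_eq, mem_slitPlane_iff_arg, harg]
      exact ⟨hmem.2.ne, by rw [ha]; exact exp_ne_zero _⟩
    · rw [hf]
      simp only
      rw [harg]
      field_simp
  calc volume (((↑) : ℝ → Torus) ⁻¹' (shift β hβ ⁻¹' s) ∩ Set.Ioc (-(1 / 2)) (-(1 / 2) + 1))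
      = volume (((↑) : ℝ → Torus) ⁻¹' (shift β hβ ⁻¹' s) ∩ Set.Ioo (-(1 / 2)) (-(1 / 2) + 1)) :=
        measure_congr ((ae_eq_refl _).inter Ioo_ae_eq_Ioc.symm)
    _ ≤ volume (f '' E) := measure_mono hcov
    _ ≤ ∫⁻ x in E, ENNReal.ofReal |(ContinuousLinearMap.toSpanSingleton ℝ (d x)).det| :=
        addHaar_image_le_lintegral_abs_det_fderiv volume hEm
          fun x hx => (hd x hx).2.hasFDerivAt.hasFDerivWithinAt
    _ ≤ ∫⁻ _ in E, ENNReal.ofReal (shiftConst β) := by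
        refine setLIntegral_mono measurable_const fun x hx => ?_
        rw [ContinuousLinearMap.det_toSpanSingleton]
        exact ENNReal.ofReal_le_ofReal (hd x hx).1
    _ = ENNReal.ofReal (shiftConst β) * volume E := setLIntegral_const _ _
    _ ≤ _ := mul_le_mul_right (measure_mono Set.inter_subset_left) _

set_option linter.unusedSectionVars false in
lemma eLpNorm_comp_shift (hβ : 1 < ‖β‖) (f : LpT p) :
    eLpNorm (fun θ => f (shift β hβ θ)) p arc ≤
      ENNReal.ofReal (shiftConst β) ^ (1 / p).toReal * eLpNorm f p arc := by
  have h1 : AEStronglyMeasurable f (Measure.map (shift β hβ) arc) :=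
    (Lp.stronglyMeasurable f).aestronglyMeasurable
  have h2 := eLpNorm_map_measure (p := p) h1 (continuous_shift β hβ).aemeasurable
  rw [← Function.comp_def f, ← h2]
  exact eLpNorm_le_of_measure_le_smul (map_shift_le β hβ)

lemma quasi_shift (hβ : 1 < ‖β‖) : Measure.QuasiMeasurePreserving (shift β hβ) arc arc :=
  ⟨(continuous_shift β hβ).measurable,
    Measure.absolutelyContinuous_of_le_smul (map_shift_le β hβ)⟩

lemma memLp_comp_shift (hβ : 1 < ‖β‖) (f : LpT p) : MemLp (fun θ => f (shift β hβ θ)) p arc :=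
  ⟨((Lp.stronglyMeasurable f).comp_measurable
      (continuous_shift β hβ).measurable).aestronglyMeasurable,
    (eLpNorm_comp_shift p β hβ f).trans_lt
      (ENNReal.mul_lt_top (ENNReal.rpow_lt_top_of_nonneg ENNReal.toReal_nonneg
        ENNReal.ofReal_ne_top) (Lp.memLp f).2)⟩

/-- The function `φ ∘ α` of `L^p` for `φ ∈ L^p`. -/
def compFun (hβ : 1 < ‖β‖) (f : LpT p) : LpT p :=
  (memLp_comp_shift p β hβ f).toLp (fun θ => f (shift β hβ θ))

lemma coeFn_compFun (hβ : 1 < ‖β‖) (f : LpT p) :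
    compFun p β hβ f =ᵐ[arc] fun θ => f (shift β hβ θ) :=
  MemLp.coeFn_toLp (memLp_comp_shift p β hβ f)

lemma compFun_add (hβ : 1 < ‖β‖) (f g : LpT p) :
    compFun p β hβ (f + g) = compFun p β hβ f + compFun p β hβ g := by
  refine Lp.ext ?_
  filter_upwards [coeFn_compFun p β hβ (f + g), coeFn_compFun p β hβ f, coeFn_compFun p β hβ g,
    Lp.coeFn_add (compFun p β hβ f) (compFun p β hβ g),
    (quasi_shift β hβ).ae (Lp.coeFn_add f g)] with θ h1 h2 h3 h4 h5
  rw [h1, h4, Pi.add_apply, h2, h3, h5, Pi.add_apply]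

lemma compFun_smul (hβ : 1 < ‖β‖) (c : ℂ) (f : LpT p) :
    compFun p β hβ (c • f) = c • compFun p β hβ f := by
  refine Lp.ext ?_
  filter_upwards [coeFn_compFun p β hβ (c • f), coeFn_compFun p β hβ f,
    Lp.coeFn_smul c (compFun p β hβ f), (quasi_shift β hβ).ae (Lp.coeFn_smul c f)]
    with θ h1 h2 h3 h4
  rw [h1, h3, Pi.smul_apply, h2, h4, Pi.smul_apply]

lemma norm_compFun_le (hβ : 1 < ‖β‖) (f : LpT p) : ‖compFun p β hβ f‖ ≤
    (ENNReal.ofReal (shiftConst β) ^ (1 / p).toReal).toReal * ‖f‖ := by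
  have h : ‖compFun p β hβ f‖ = (eLpNorm (fun θ => f (shift β hβ θ)) p arc).toReal :=
    Lp.norm_toLp _ (memLp_comp_shift p β hβ f)
  rw [h, Lp.norm_def, ← ENNReal.toReal_mul]
  exact ENNReal.toReal_mono (ENNReal.mul_ne_top (ENNReal.rpow_ne_top_of_nonneg
    ENNReal.toReal_nonneg ENNReal.ofReal_ne_top) (Lp.memLp f).2.ne)
    (eLpNorm_comp_shift p β hβ f)

/-- The composition operator `φ ↦ φ ∘ α` on `L^p`. -/
def compShift (hβ : 1 < ‖β‖) : LpT p →L[ℂ] LpT p :=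
  LinearMap.mkContinuous
    { toFun := compFun p β hβ
      map_add' := compFun_add p β hβ
      map_smul' := compFun_smul p β hβ }
    _ (norm_compFun_le p β hβ)

lemma alphaMinus_ne_zero {z : ℂ} (hβ : 1 < ‖β‖) (hz : ‖z‖ = 1) : alphaMinus β z ≠ 0 :=
  div_ne_zero (mul_ne_zero (lam_ne_zero hβ) (norm_pos_iff.1 (hz ▸ one_pos))) (den_ne_zero hβ hz)

lemma continuous_alphaMinus_pt (hβ : 1 < ‖β‖) : Continuous fun θ : Torus => alphaMinus β (pt θ) :=
  (continuous_const.mul continuous_pt).div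
    ((continuous_const.mul continuous_pt).sub continuous_const)
    fun θ => den_ne_zero hβ (norm_pt θ)

/-- The function `t⁻¹ α₋(t)` on `𝕋`. -/
def weight (hβ : 1 < ‖β‖) : C(Torus, ℂ) where
  toFun θ := (pt θ)⁻¹ * alphaMinus β (pt θ)
  continuous_toFun := (continuous_pt.inv₀ pt_ne_zero).mul (continuous_alphaMinus_pt β hβ)

/-- The function `χ` on `𝕋`. -/
def chi (hβ : 1 < ‖β‖) : C(Torus, ℂ) where
  toFun θ := chiFun β (pt θ)
  continuous_toFun := continuous_pt.div (continuous_alphaMinus_pt β hβ)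
    fun θ => alphaMinus_ne_zero β hβ (norm_pt θ)

/-- The function `χ⁻¹` on `𝕋`. -/
def chiInv (hβ : 1 < ‖β‖) : C(Torus, ℂ) where
  toFun θ := (chiFun β (pt θ))⁻¹
  continuous_toFun := (chi β hβ).continuous.inv₀
    fun θ => div_ne_zero (pt_ne_zero θ) (alphaMinus_ne_zero β hβ (norm_pt θ))

/-- The weighted shift operator `J_α φ(t) = t⁻¹ α₋(t) φ(α(t))` on `L^p`. -/
def shiftOp (hβ : 1 < ‖β‖) : LpT p →L[ℂ] LpT p :=
  mulOp p (ofCont (weight β hβ)) ∘L compShift p β hβ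

/-! ## Toeplitz and generalized Hankel operators -/

/-- The Toeplitz operator `T(a) : H^p → H^p`, `φ ↦ P a φ`. -/
def toeplitz (a : Linf) : Hardy p →L[ℂ] Hardy p :=
  rieszPH p ∘L mulOp p a ∘L (Hardy p).subtypeL

/-- The generalized Hankel operator `H_α(b) : H^p → H^p`, `φ ↦ P b Q J_α φ`. -/
def hankel (hβ : 1 < ‖β‖) (b : Linf) : Hardy p →L[ℂ] Hardy p :=
  rieszPH p ∘L mulOp p b ∘L rieszQ p ∘L shiftOp p β hβ ∘L (Hardy p).subtypeL

/-- The adjoint `A* : X* → X*`, `ℓ ↦ ℓ ∘ A`, of a bounded operator `A` on a Banach space `X`. -/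
def bAdjoint {X : Type*} [NormedAddCommGroup X] [NormedSpace ℂ X] (A : X →L[ℂ] X) :
    StrongDual ℂ X →L[ℂ] StrongDual ℂ X :=
  ContinuousLinearMap.precomp ℂ A

/-- `coker A = {x ∈ X* : A* x = 0}`. -/
def coker {X : Type*} [NormedAddCommGroup X] [NormedSpace ℂ X] (A : X →L[ℂ] X) :
    Submodule ℂ (StrongDual ℂ X) :=
  LinearMap.ker (bAdjoint A).toLinearMap

/-- `ker A = {0}` or `coker A = {0}`. -/
def KerOrCokerTrivial {X : Type*} [NormedAddCommGroup X] [NormedSpace ℂ X] (A : X →L[ℂ] X) :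
    Prop :=
  LinearMap.ker A.toLinearMap = ⊥ ∨ coker A = ⊥

end GenHankel

end

open GenHankel

noncomputable section

namespace GenHankel

/-! On `H^p` the operator `J_α` takes values in `ker P`, so the factor `Q` in `H_α(b)` is redundant
there. Hence each of the four operators has the form `A f = P a (f + U f)`, where `U f = u · (f ∘
α)` equals `±J_α`, the composition operator `f ↦ f ∘ α = χ J_α f`, or `-χ⁻¹ J_α`. In each case `U`
is an involution and `I + U` maps `H^p` bijectively onto the fixed space of `U`.

From this, `kerOrCokerTrivial_of_involution` runs a Coburn argument. Suppose `f ≠ 0` and `A f = 0`.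
Then `g = f + U f` is a nonzero fixed point of `U`, and `F = a g` is a nonzero element of `ker P`.
Let `ℓ` vanish on the range of `A` and put `L = ℓ ∘ P`. If `s` is continuous and `s ∘ α = s`, then
`s g` is fixed by `U`, so `s g = x + U x` with `x ∈ H^p` and `L (s F) = ℓ (A x) = 0`. For `n > 0`
this applies to `s = tⁿ + αⁿ`; the pole of `α` lies in the disc, so `αⁿ F ∈ ker P`, and `L (tⁿ F) =
0` follows. For `n ≤ 0` already `tⁿ F ∈ ker P`. Thus `L` kills every continuous multiple of `F`.
These multiples are dense in `L^p` because `F` vanishes almost nowhere, so `L = 0` and `ℓ = 0`.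

Two classical facts support this. One is the M. Riesz theorem (`cut_bound`,
`exists_riesz_projection`): a pointwise inequality in the right half-plane together with the mean
value property gives `1 < p ≤ 2`, and duality gives `p > 2`. The other is that a nonzero function
with spectrum bounded above is nonzero almost everywhere (`ae_ne_zero_of_coeff`), which comes from
Jensen's inequality. -/

/-! ## Trigonometric polynomials and Fourier coefficients -/

/-- The trigonometric polynomial `∑ cₙ tⁿ`. -/
def trig : (ℤ →₀ ℂ) →ₗ[ℂ] C(Torus, ℂ) :=
  Finsupp.linearCombination ℂ (fun n : ℤ => (fourier n : C(Torus, ℂ)))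

/-- The coefficients with indices `n ≥ 0`. -/
def cut : (ℤ →₀ ℂ) →ₗ[ℂ] (ℤ →₀ ℂ) where
  toFun c := c.filter (0 ≤ ·)
  map_add' _ _ := Finsupp.filter_add
  map_smul' _ _ := Finsupp.filter_smul

lemma cut_apply (c : ℤ →₀ ℂ) (n : ℤ) : cut c n = if 0 ≤ n then c n else 0 :=
  Finsupp.filter_apply _ _ _

/-- A continuous function as an element of `L^p`. -/
abbrev cl (p : ℝ≥0∞) [Fact (1 ≤ p)] : C(Torus, ℂ) →L[ℂ] LpT p :=
  ContinuousMap.toLp p arc ℂ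

lemma trig_single (n : ℤ) (c : ℂ) : trig (Finsupp.single n c) = c • (fourier n : C(Torus, ℂ)) := by
  simp [trig]

lemma dense_range_trig : DenseRange trig := by
  have h := span_fourier_closure_eq_top (T := (1 : ℝ))
  rw [← Finsupp.range_linearCombination] at h
  have h2 := congrArg (fun S : Submodule ℂ C(Torus, ℂ) => (S : Set C(Torus, ℂ))) h
  simp only [Submodule.topologicalClosure_coe, Submodule.top_coe] at h2
  intro x
  have : x ∈ closure ((LinearMap.range trig : Submodule ℂ C(Torus, ℂ)) : Set C(Torus, ℂ)) := by
    rw [trig, h2]; trivial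
  rwa [LinearMap.coe_range] at this

section

variable {p : ℝ≥0∞} [Fact (1 ≤ p)]

lemma dense_range_cl_trig (hp : p ≠ ∞) : DenseRange ((cl p).toLinearMap ∘ₗ trig) :=
  (ContinuousMap.toLp_denseRange ℂ arc ℂ hp).comp dense_range_trig (cl p).continuous

lemma coeFn_cl (f : C(Torus, ℂ)) : cl p f =ᵐ[arc] f := ContinuousMap.coeFn_toLp arc f

lemma fourierCoeff_cl (f : C(Torus, ℂ)) (n : ℤ) : fourierCoeff (cl p f) n = fourierCoeff f n := by
  rw [fourierCoeff_congr_ae (coeFn_cl f)]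

lemma integrable_cont {E : Type*} [NormedAddCommGroup E] {f : Torus → E} (hf : Continuous f) :
    Integrable f arc :=
  hf.integrable_of_hasCompactSupport (HasCompactSupport.of_compactSpace f)

lemma fourierCoeff_trig (c : ℤ →₀ ℂ) (n : ℤ) : fourierCoeff (trig c) n = c n := by
  induction c using Finsupp.induction_linear with
  | zero => simp [fourierCoeff]
  | add c d hc hd =>
    rw [map_add, ContinuousMap.coe_add, fourierCoeff.add (integrable_cont (trig c).continuous)
      (integrable_cont (trig d).continuous), Pi.add_apply, hc, hd, Finsupp.add_apply]
  | single m a =>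
    rw [trig_single, ContinuousMap.coe_smul, fourierCoeff.const_smul, fourierCoeff_fourier,
      Finsupp.single_apply]
    by_cases h : m = n
    · subst h; simp
    · simp [h, Ne.symm h]

lemma norm_fourierCoeff_le (f : LpT p) (n : ℤ) : ‖fourierCoeff f n‖ ≤ ‖f‖ := by
  have h1 : ‖fourierCoeff f n‖ ≤ ∫ θ, ‖f θ‖ ∂arc := by
    refine (norm_integral_le_integral_norm _).trans (le_of_eq ?_)
    refine integral_congr_ae (.of_forall fun θ => ?_)
    simp [Circle.norm_coe]
  refine h1.trans ?_
  rw [integral_norm_eq_lintegral_enorm (integrable_coe p f).1, Lp.norm_def,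
    ← eLpNorm_one_eq_lintegral_enorm]
  exact ENNReal.toReal_mono (Lp.memLp f).2.ne
    (eLpNorm_le_eLpNorm_of_exponent_le Fact.out (integrable_coe p f).1)

/-- The `n`-th Fourier coefficient as a bounded functional on `L^p`. -/
def coeffL (p : ℝ≥0∞) [Fact (1 ≤ p)] (n : ℤ) : LpT p →L[ℂ] ℂ :=
  LinearMap.mkContinuous
    { toFun := fun f => fourierCoeff f n
      map_add' := fun f g => by
        rw [fourierCoeff_congr_ae (Lp.coeFn_add f g),
          fourierCoeff.add (integrable_coe p f) (integrable_coe p g), Pi.add_apply]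
      map_smul' := fun c f => by
        rw [fourierCoeff_congr_ae (Lp.coeFn_smul c f), fourierCoeff.const_smul]; rfl }
    1 (fun f => by rw [one_mul]; exact norm_fourierCoeff_le f n)

lemma coeffL_apply (n : ℤ) (f : LpT p) : coeffL p n f = fourierCoeff f n := rfl

lemma norm_coeffL_le (f : LpT p) (n : ℤ) : ‖coeffL p n f‖ ≤ ‖f‖ := norm_fourierCoeff_le f n

lemma coeffL_cl (f : C(Torus, ℂ)) (n : ℤ) : coeffL p n (cl p f) = fourierCoeff f n :=
  fourierCoeff_cl f n

/-! ### Uniqueness of Fourier coefficients. -/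

lemma integrable_cont_mul {g : Torus → ℂ} (hg : Integrable g arc) (f : C(Torus, ℂ)) :
    Integrable (fun θ => f θ * g θ) arc :=
  hg.bdd_mul f.continuous.aestronglyMeasurable (.of_forall fun θ => f.norm_coe_le_norm θ)

/-- The integral is bounded in `f` for the uniform norm and vanishes on the uniformly dense
trigonometric polynomials. -/
lemma integral_cont_mul_eq_zero {g : Torus → ℂ} (hg : Integrable g arc)
    (h : ∀ n, fourierCoeff g n = 0) (f : C(Torus, ℂ)) : ∫ θ, f θ * g θ ∂arc = 0 := by
  let Φ : C(Torus, ℂ) →L[ℂ] ℂ := LinearMap.mkContinuous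
    { toFun := fun f => ∫ θ, f θ * g θ ∂arc
      map_add' := fun f₁ f₂ => by
        rw [← integral_add (integrable_cont_mul hg f₁) (integrable_cont_mul hg f₂)]
        simp [add_mul]
      map_smul' := fun c f => by
        simp [mul_assoc, integral_const_mul] }
    (∫ θ, ‖g θ‖ ∂arc) (fun f => by
      refine (norm_integral_le_integral_norm _).trans ?_
      rw [mul_comm, ← integral_const_mul]
      refine integral_mono (integrable_cont_mul hg f).norm (hg.norm.const_mul _) fun θ => ?_
      rw [norm_mul]
      exact mul_le_mul_of_nonneg_right (f.norm_coe_le_norm θ) (norm_nonneg _))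
  have h0 : ∀ c, Φ (trig c) = 0 := fun c => by
    induction c using Finsupp.induction_linear with
    | zero => simp
    | add c d hc hd => rw [map_add, map_add, hc, hd, add_zero]
    | single m a =>
      rw [trig_single, map_smul]
      have := h (-m)
      rw [fourierCoeff, neg_neg] at this
      change a • (∫ θ, fourier m θ * g θ ∂arc) = 0
      simp only [smul_eq_mul] at this
      rw [this, smul_zero]
  exact dense_range_trig.induction_on (p := fun f => Φ f = 0) f
    (isClosed_eq Φ.continuous continuous_const) h0

/-- An integrable function is determined by its Fourier coefficients. -/
lemma ae_eq_zero_of_fourierCoeff {g : Torus → ℂ} (hg : Integrable g arc)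
    (h : ∀ n, fourierCoeff g n = 0) : g =ᵐ[arc] 0 := by
  refine ae_eq_zero_of_forall_setIntegral_isClosed_eq_zero hg fun s hs => ?_
  -- The indicator of a closed set is a bounded pointwise limit of continuous functions, and
  -- integrals over closed sets determine `g`.
  have key : Filter.Tendsto (fun n => ∫ θ, ((hs.apprSeq n θ : ℝ) : ℂ) * g θ ∂arc) Filter.atTop
      (nhds (∫ θ, s.indicator g θ ∂arc)) := by
    refine tendsto_integral_of_dominated_convergence (fun θ => ‖g θ‖) (fun n => ?_) hg.norm
      (fun n => .of_forall fun θ => ?_) (.of_forall fun θ => ?_)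
    · exact (integrable_cont_mul hg ⟨fun θ => ((hs.apprSeq n θ : ℝ) : ℂ), by fun_prop⟩).1
    · rw [norm_mul, norm_real]
      refine mul_le_of_le_one_left (norm_nonneg _) ?_
      rw [Real.norm_of_nonneg (NNReal.coe_nonneg _)]
      exact_mod_cast HasOuterApproxClosed.apprSeq_apply_le_one hs n θ
    · have h1 := (tendsto_pi_nhds.1 (HasOuterApproxClosed.tendsto_apprSeq hs)) θ
      have h2 : Filter.Tendsto (fun n => ((hs.apprSeq n θ : ℝ) : ℂ) * g θ) Filter.atTop
          (nhds ((((s.indicator (fun _ => (1 : NNReal)) θ : NNReal) : ℝ) : ℂ) * g θ)) :=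
        ((continuous_ofReal.comp NNReal.continuous_coe).continuousAt.tendsto.comp h1).mul_const _
      convert h2 using 2
      by_cases hθ : θ ∈ s <;> simp [hθ]
  rw [← integral_indicator hs.measurableSet]
  refine tendsto_nhds_unique (key.congr fun n => ?_) tendsto_const_nhds
  exact integral_cont_mul_eq_zero hg h ⟨fun θ => ((hs.apprSeq n θ : ℝ) : ℂ), by fun_prop⟩

lemma ext_coeff {f g : LpT p} (h : ∀ n, coeffL p n f = coeffL p n g) : f = g := by
  rw [← sub_eq_zero]
  have : ∀ n, fourierCoeff (f - g : LpT p) n = 0 := fun n => by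
    rw [← coeffL_apply, map_sub, h n, sub_self]
  exact (Lp.eq_zero_iff_ae_eq_zero).2 (ae_eq_zero_of_fourierCoeff (integrable_coe p _) this)

/-! ### Norms of continuous functions in `L^p`. -/

lemma norm_cl_le (f : C(Torus, ℂ)) : ‖cl p f‖ ≤ ‖f‖ := by
  refine ((cl p).le_opNorm f).trans ?_
  have := ContinuousMap.toLp_norm_le (p := p) arc (E := ℂ) (𝕜 := ℂ)
  have h1 : ‖cl p‖ ≤ 1 := by simpa [measureUnivNNReal] using this
  exact mul_le_of_le_one_left (norm_nonneg _) h1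

lemma norm_cl_mono {f g : C(Torus, ℂ)} (h : ∀ θ, ‖f θ‖ ≤ ‖g θ‖) : ‖cl p f‖ ≤ ‖cl p g‖ := by
  refine Lp.norm_le_norm_of_ae_le ?_
  filter_upwards [coeFn_cl (p := p) f, coeFn_cl (p := p) g] with θ h1 h2
  rw [h1, h2]
  exact h θ

lemma norm_cl_eq (f : C(Torus, ℂ)) : ‖cl p f‖ = (eLpNorm f p arc).toReal := by
  rw [Lp.norm_def, eLpNorm_congr_ae (coeFn_cl f)]

lemma norm_cl_le_of_le {q : ℝ≥0∞} [Fact (1 ≤ q)] (hpq : p ≤ q) (f : C(Torus, ℂ)) :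
    ‖cl p f‖ ≤ ‖cl q f‖ := by
  rw [norm_cl_eq, norm_cl_eq]
  exact ENNReal.toReal_mono (ContinuousMap.memLp (p := q) arc ℂ f).2.ne
    (eLpNorm_le_eLpNorm_of_exponent_le hpq f.continuous.aestronglyMeasurable)

lemma norm_cl_rpow (hp : p ≠ ∞) (f : C(Torus, ℂ)) :
    ‖cl p f‖ ^ p.toReal = ∫ θ, ‖f θ‖ ^ p.toReal ∂arc := by
  have hp0 : p ≠ 0 := (one_pos.trans_le (Fact.out : 1 ≤ p)).ne'
  have h0 : 0 ≤ ∫ θ, ‖f θ‖ ^ p.toReal ∂arc := integral_nonneg fun θ => by positivity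
  rw [norm_cl_eq, (ContinuousMap.memLp (p := p) arc ℂ f).eLpNorm_eq_integral_rpow_norm hp0 hp,
    ENNReal.toReal_ofReal (by positivity), ← Real.rpow_mul h0,
    inv_mul_cancel₀ (ENNReal.toReal_pos hp0 hp).ne', Real.rpow_one]

end

/-! ## Bounds for analytic trigonometric polynomials with positive real part -/

/-- Write `z = ρ e^{iφ}` with `|φ| < π/2`. Near the imaginary axis `cos (rφ)` is negative, so the
`B` term alone dominates `ρ^r`; elsewhere `cos φ` is bounded below and the `A` term suffices. Since
`r ≤ 2`, `rφ` stays in `[0, π]`, where the cosine decreases. -/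
lemma exists_norm_rpow_le {r : ℝ} (hr : 1 < r) (hr2 : r ≤ 2) :
    ∃ A B : ℝ, 0 ≤ A ∧ 0 ≤ B ∧ ∀ z : ℂ, 0 < z.re →
      ‖z‖ ^ r ≤ A * z.re ^ r - B * (z ^ (r : ℂ)).re := by
  have hpi := Real.pi_pos
  have hr0 : 0 < r := by linarith
  -- Any angle between `π/(2r)` and `π/2` separates the two regimes: it makes `cos (rγ) < 0 < cos
  -- γ`. Then `B` is fixed by `B cos (rγ) = -1` and `A` by `A (cos γ)^r = 1 + B`.
  set γ : ℝ := (Real.pi / (2 * r) + Real.pi / 2) / 2 with hγ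
  have h1 : Real.pi / (2 * r) < Real.pi / 2 := by
    apply div_lt_div_of_pos_left hpi <;> linarith
  have hγ2 : γ < Real.pi / 2 := by rw [hγ]; linarith
  have hγ1 : Real.pi / (2 * r) < γ := by rw [hγ]; linarith
  have hγ0 : 0 < γ := lt_trans (by positivity) hγ1
  have hrγ : Real.pi / 2 < r * γ := by
    have := (mul_lt_mul_iff_right₀ hr0).2 hγ1
    have e : r * (Real.pi / (2 * r)) = Real.pi / 2 := by field_simp
    linarith
  have hrγ2 : r * γ ≤ Real.pi := by nlinarith
  have hc : Real.cos (r * γ) < 0 := Real.cos_neg_of_pi_div_two_lt_of_lt hrγ (by linarith)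
  have hcγ : 0 < Real.cos γ := Real.cos_pos_of_mem_Ioo ⟨by linarith, hγ2⟩
  set B : ℝ := (-Real.cos (r * γ))⁻¹ with hB
  have hB0 : 0 < B := inv_pos.2 (by linarith)
  set A : ℝ := (1 + B) / Real.cos γ ^ r with hA
  have hcr : 0 < Real.cos γ ^ r := Real.rpow_pos_of_pos hcγ r
  have hA0 : 0 < A := by positivity
  refine ⟨A, B, hA0.le, hB0.le, fun z hz => ?_⟩
  have hz0 : z ≠ 0 := by rintro rfl; simp at hz
  set φ : ℝ := |z.arg| with hφ
  have hφ2 : φ < Real.pi / 2 := by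
    rw [hφ, abs_arg_lt_pi_div_two_iff]; exact Or.inl hz
  have hφ0 : 0 ≤ φ := abs_nonneg _
  have hre : z.re = ‖z‖ * Real.cos φ := by rw [hφ, Real.cos_abs, norm_mul_cos_arg]
  have hpow : (z ^ (r : ℂ)).re = ‖z‖ ^ r * Real.cos (r * φ) := by
    rw [cpow_ofReal_re, hφ, ← Real.cos_abs (z.arg * r), abs_mul, abs_of_pos hr0, mul_comm r]
  have hcφ : 0 < Real.cos φ := Real.cos_pos_of_mem_Ioo ⟨by linarith, hφ2⟩
  have key : 1 ≤ A * Real.cos φ ^ r - B * Real.cos (r * φ) := by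
    rcases le_total γ φ with h | h
    · have h2 : Real.cos (r * φ) ≤ Real.cos (r * γ) := by
        apply Real.cos_le_cos_of_nonneg_of_le_pi
        · positivity
        · nlinarith
        · gcongr
      have h3 : B * Real.cos (r * φ) ≤ -1 := by
        have : B * Real.cos (r * γ) = -1 := by
          rw [hB, inv_neg, neg_mul, inv_mul_cancel₀ hc.ne]
        rw [← this]; gcongr
      have : 0 ≤ A * Real.cos φ ^ r := by positivity
      linarith
    · have h2 : Real.cos γ ≤ Real.cos φ :=
        Real.cos_le_cos_of_nonneg_of_le_pi hφ0 (by linarith) h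
      have h3 : 1 + B ≤ A * Real.cos φ ^ r := by
        calc 1 + B = A * Real.cos γ ^ r := by rw [hA]; field_simp
          _ ≤ _ := by gcongr
      have : B * Real.cos (r * φ) ≤ B := mul_le_of_le_one_right hB0.le (Real.cos_le_one _)
      linarith
  rw [hpow, hre, Real.mul_rpow (norm_nonneg _) hcφ.le]
  have := mul_le_mul_of_nonneg_left key (Real.rpow_nonneg (norm_nonneg z) r)
  linarith

lemma integral_pt_eq_circleAverage {E : Type*} [NormedAddCommGroup E] [NormedSpace ℝ E]
    (F : ℂ → E) : ∫ θ, F (pt θ) ∂arc = Real.circleAverage F 0 1 := by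
  rw [arc_eq_volume, ← AddCircle.intervalIntegral_preimage 1 0 (fun θ => F (pt θ)),
    Real.circleAverage]
  have h := intervalIntegral.integral_comp_mul_left (a := 0) (b := 1)
    (fun x => F (circleMap 0 1 x)) (c := 2 * Real.pi) (by positivity)
  rw [mul_zero, mul_one] at h
  rw [← h, zero_add]
  refine intervalIntegral.integral_congr fun x _ => ?_
  simp only [pt_coe, circleMap]
  push_cast
  simp

/-- Maximum modulus principle for `exp (-q)`, whose modulus is `exp (-Re q)`. -/
lemma re_pos_of_re_pos_on_circle (q : Polynomial ℂ) (hq : ∀ θ, 0 < (q.eval (pt θ)).re) {z : ℂ}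
    (hz : z ∈ Metric.closedBall (0 : ℂ) 1) : 0 < (q.eval z).re := by
  have hcont : Continuous fun θ : Torus => (q.eval (pt θ)).re :=
    continuous_re.comp (q.continuous.comp continuous_pt)
  obtain ⟨θ₀, h₀⟩ : ∃ θ₀ : Torus, ∀ θ, (q.eval (pt θ₀)).re ≤ (q.eval (pt θ)).re := by
    obtain ⟨θ₀, -, h⟩ := isCompact_univ.exists_isMinOn Set.univ_nonempty hcont.continuousOn
    exact ⟨θ₀, fun θ => h (Set.mem_univ θ)⟩
  have hd : DiffContOnCl ℂ (fun w : ℂ => exp (-(q.eval w))) (Metric.ball 0 1) :=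
    (q.differentiable.neg.cexp).diffContOnCl
  have h1 : ‖exp (-(q.eval z))‖ ≤ Real.exp (-(q.eval (pt θ₀)).re) := by
    refine Complex.norm_le_of_forall_mem_frontier_norm_le Metric.isBounded_ball hd
      (fun w hw => ?_) (by rwa [closure_ball _ one_ne_zero])
    rw [frontier_ball _ one_ne_zero] at hw
    obtain ⟨θ, hθ⟩ : ∃ θ : Torus, pt θ = w := by
      obtain ⟨θ, h⟩ := (AddCircle.homeomorphCircle (one_ne_zero (α := ℝ))).surjective ⟨w, hw⟩
      refine ⟨θ, ?_⟩
      rw [AddCircle.homeomorphCircle_apply] at h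
      exact congrArg Subtype.val h
    rw [norm_exp, neg_re, ← hθ]
    exact Real.exp_le_exp.2 (neg_le_neg (h₀ θ))
  rw [norm_exp, neg_re, Real.exp_le_exp, neg_le_neg_iff] at h1
  exact (hq θ₀).trans_le h1

/-- Mean value property: `q` maps the closed disc into the right half-plane, so the principal branch
of `q ^ r` is holomorphic there. -/
lemma integral_eval_cpow (q : Polynomial ℂ) (hq : ∀ θ, 0 < (q.eval (pt θ)).re) (r : ℂ) :
    ∫ θ, q.eval (pt θ) ^ r ∂arc = q.eval 0 ^ r := by
  rw [integral_pt_eq_circleAverage fun z => q.eval z ^ r]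
  refine DiffContOnCl.circleAverage (f := fun z => q.eval z ^ r) (c := 0) (R := 1) ?_
  rw [abs_one]
  refine DifferentiableOn.diffContOnCl ?_
  rw [closure_ball _ one_ne_zero]
  intro z hz
  refine (DifferentiableAt.cpow_const q.differentiable.differentiableAt ?_).differentiableWithinAt
  exact Or.inl (re_pos_of_re_pos_on_circle q hq hz)

lemma continuous_eval_pt (q : Polynomial ℂ) : Continuous fun θ : Torus => q.eval (pt θ) :=
  q.continuous.comp continuous_pt

/-- On integrating the pointwise inequality, the subtracted term becomes `B · Re (q(0)^r)`. It is
nonnegative because `q(0)` is a positive real, and can be dropped. -/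
lemma integral_norm_rpow_le {r A B : ℝ} (hr : 0 < r) (hB : 0 ≤ B)
    (h : ∀ z : ℂ, 0 < z.re → ‖z‖ ^ r ≤ A * z.re ^ r - B * (z ^ (r : ℂ)).re)
    (q : Polynomial ℂ) (hq : ∀ θ, 0 < (q.eval (pt θ)).re) (h0 : (q.eval 0).im = 0) :
    ∫ θ, ‖q.eval (pt θ)‖ ^ r ∂arc ≤ A * ∫ θ, (q.eval (pt θ)).re ^ r ∂arc := by
  have hc := continuous_eval_pt q
  have hc1 : Continuous fun θ : Torus => ‖q.eval (pt θ)‖ ^ r :=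
    hc.norm.rpow_const fun _ => Or.inr hr.le
  have hc2 : Continuous fun θ : Torus => (q.eval (pt θ)).re ^ r :=
    (continuous_re.comp hc).rpow_const fun _ => Or.inr hr.le
  have hc3 : Continuous fun θ : Torus => q.eval (pt θ) ^ (r : ℂ) :=
    hc.cpow continuous_const fun θ => Or.inl (hq θ)
  have hre : ∫ θ, (q.eval (pt θ) ^ (r : ℂ)).re ∂arc = (q.eval 0 ^ (r : ℂ)).re := by
    rw [← integral_eval_cpow q hq]
    exact integral_re (integrable_cont hc3)
  have hpos : 0 ≤ (q.eval 0 ^ (r : ℂ)).re := by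
    have h1 := re_pos_of_re_pos_on_circle q hq (z := 0) (by simp)
    have : q.eval 0 = ((q.eval 0).re : ℂ) := Complex.ext rfl (by simp [h0])
    rw [this, ← ofReal_cpow h1.le, ofReal_re]
    positivity
  have i2 : Integrable (fun θ => A * (q.eval (pt θ)).re ^ r) arc := (integrable_cont hc2).const_mul A
  have i3 : Integrable (fun θ => B * (q.eval (pt θ) ^ (r : ℂ)).re) arc :=
    (integrable_cont (continuous_re.comp hc3)).const_mul B
  calc ∫ θ, ‖q.eval (pt θ)‖ ^ r ∂arc
      ≤ ∫ θ, (A * (q.eval (pt θ)).re ^ r - B * (q.eval (pt θ) ^ (r : ℂ)).re) ∂arc :=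
        integral_mono (integrable_cont hc1) (i2.sub i3) fun θ => h _ (hq θ)
    _ = A * ∫ θ, (q.eval (pt θ)).re ^ r ∂arc - B * (q.eval 0 ^ (r : ℂ)).re := by
        rw [integral_sub i2 i3, integral_const_mul, integral_const_mul, hre]
    _ ≤ _ := by
        have := mul_nonneg hB hpos
        linarith

/-! ## The Riesz projection on trigonometric polynomials -/

lemma fourier_eq_zpow (n : ℤ) (θ : Torus) : (fourier n : C(Torus, ℂ)) θ = pt θ ^ n := by
  rw [fourier_apply, AddCircle.toCircle_zsmul, Circle.coe_zpow, pt]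

/-- This extends the analytic part of a trigonometric polynomial to the disc, where function theory
applies. -/
lemma exists_polynomial (c : ℤ →₀ ℂ) :
    ∃ q : Polynomial ℂ, (∀ θ, q.eval (pt θ) = trig (cut c) θ) ∧ q.eval 0 = c 0 := by
  induction c using Finsupp.induction_linear with
  | zero => exact ⟨0, by simp⟩
  | add c d hc hd =>
    obtain ⟨q, h1, h2⟩ := hc
    obtain ⟨s, h3, h4⟩ := hd
    exact ⟨q + s, fun θ => by simp [h1, h3], by simp [h2, h4]⟩
  | single n a =>
    by_cases hn : 0 ≤ n
    · have hcut : cut (Finsupp.single n a) = Finsupp.single n a :=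
        Finsupp.filter_single_of_pos _ hn
      obtain ⟨m, rfl⟩ := Int.eq_ofNat_of_zero_le hn
      refine ⟨Polynomial.monomial m a, fun θ => ?_, ?_⟩
      · rw [hcut, trig_single, Polynomial.eval_monomial, ContinuousMap.smul_apply,
          fourier_eq_zpow, zpow_natCast, smul_eq_mul]
      · rw [Polynomial.eval_monomial, Finsupp.single_apply]
        rcases m with _ | m
        · simp
        · simp; omega
    · have hcut : cut (Finsupp.single n a) = 0 := Finsupp.filter_single_of_neg _ hn
      refine ⟨0, fun θ => by simp [hcut], ?_⟩
      rw [Finsupp.single_apply, if_neg (by omega)]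
      simp

/-- The coefficients of the complex conjugate of a trigonometric polynomial. -/
def conjCoeff (c : ℤ →₀ ℂ) : ℤ →₀ ℂ :=
  (c.equivMapDomain (Equiv.neg ℤ)).mapRange conj (map_zero _)

lemma conjCoeff_apply (c : ℤ →₀ ℂ) (n : ℤ) : conjCoeff c n = conj (c (-n)) := by
  simp [conjCoeff]

lemma trig_conjCoeff (c : ℤ →₀ ℂ) (θ : Torus) : trig (conjCoeff c) θ = conj (trig c θ) := by
  induction c using Finsupp.induction_linear with
  | zero =>
    have : conjCoeff 0 = 0 := by ext n; simp [conjCoeff_apply]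
    simp [this]
  | add c d hc hd =>
    have : conjCoeff (c + d) = conjCoeff c + conjCoeff d := by ext n; simp [conjCoeff_apply]
    simp [this, hc, hd]
  | single n a =>
    have : conjCoeff (Finsupp.single n a) = Finsupp.single (-n) (conj a) := by
      simp [conjCoeff, Finsupp.equivMapDomain_single]
    rw [this, trig_single, trig_single]
    simp only [ContinuousMap.smul_apply, smul_eq_mul, map_mul, fourier_neg]

lemma trig_injective : Function.Injective trig := fun c d h => by
  ext n
  rw [← fourierCoeff_trig, h, fourierCoeff_trig]

/-- For real values the negative coefficients are conjugates of the positive ones; the constant term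
is counted twice, hence the correction. -/
lemma trig_eq_cut_add_conj {c : ℤ →₀ ℂ} (hc : ∀ θ, (trig c θ).im = 0) (θ : Torus) :
    trig c θ = trig (cut c) θ + conj (trig (cut c) θ) - c 0 := by
  have h1 : conjCoeff c = c := trig_injective <| ContinuousMap.ext fun θ => by
    rw [trig_conjCoeff]
    exact conj_eq_iff_im.2 (hc θ)
  have h2 : ∀ n, conj (c (-n)) = c n := fun n => by rw [← conjCoeff_apply, h1]
  have h3 : c = cut c + conjCoeff (cut c) - Finsupp.single 0 (c 0) := by
    ext n
    rw [Finsupp.sub_apply, Finsupp.add_apply, conjCoeff_apply, cut_apply, cut_apply,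
      Finsupp.single_apply]
    rcases lt_trichotomy n 0 with h | rfl | h
    · rw [if_neg (by omega), if_pos (by omega), if_neg (by omega), h2]; ring
    · have := h2 0
      rw [neg_zero] at this
      simp [this]
    · rw [if_pos (by omega), if_neg (by omega), if_neg (by omega)]; simp
  conv_lhs => rw [h3]
  rw [map_sub, map_add, ContinuousMap.sub_apply, ContinuousMap.add_apply, trig_conjCoeff,
    trig_single]
  simp

section

variable {p : ℝ≥0∞} [Fact (1 ≤ p)]

lemma norm_coeff_le_trig (c : ℤ →₀ ℂ) (n : ℤ) : ‖c n‖ ≤ ‖cl p (trig c)‖ := by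
  rw [← fourierCoeff_trig, ← coeffL_cl (p := p)]
  exact norm_coeffL_le _ _

lemma cut_bound_of_pos (hp1 : 1 < p) (hp2 : p ≤ 2) :
    ∃ C : ℝ, 0 ≤ C ∧ ∀ c : ℤ →₀ ℂ, (∀ θ, (trig c θ).im = 0) → (∀ θ, 0 < (trig c θ).re) →
      ‖cl p (trig (cut c))‖ ≤ C * ‖cl p (trig c)‖ := by
  have hpt : p ≠ ∞ := ne_top_of_le_ne_top (by simp) hp2
  set r := p.toReal with hr
  have hr1 : 1 < r := by
    have := (ENNReal.toReal_lt_toReal (by simp) hpt).2 hp1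
    simpa using this
  have hr2 : r ≤ 2 := by
    have := (ENNReal.toReal_le_toReal hpt (by simp)).2 hp2
    simpa using this
  have hr0 : 0 < r := by linarith
  obtain ⟨A, B, hA, hB, hAB⟩ := exists_norm_rpow_le hr1 hr2
  refine ⟨(A ^ r⁻¹ + 1) / 2, by positivity, fun c him hre => ?_⟩
  obtain ⟨q, hq, hq0⟩ := exists_polynomial c
  -- This is the analytic completion of `trig c`: its real part on the circle is `trig c`, and its
  -- value at `0` is the real number `c 0`.
  set s : Polynomial ℂ := 2 * q - Polynomial.C (c 0) with hs
  have hs1 : ∀ θ, s.eval (pt θ) = 2 * trig (cut c) θ - c 0 := fun θ => by simp [hs, hq]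
  have hc0 : (c 0).im = 0 := by
    have h := congrArg im (trig_eq_cut_add_conj him 0)
    simpa [him] using h
  have hsre : ∀ θ, (s.eval (pt θ)).re = (trig c θ).re := fun θ => by
    rw [hs1, trig_eq_cut_add_conj him θ]
    simp
    ring
  let S : C(Torus, ℂ) := ⟨fun θ => s.eval (pt θ), continuous_eval_pt s⟩
  have h1 := integral_norm_rpow_le hr0 hB hAB s (fun θ => (hsre θ).symm ▸ hre θ)
    (by simp [hs, hq0, hc0])
  have h2 : ‖cl p S‖ ^ r ≤ A * ‖cl p (trig c)‖ ^ r := by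
    rw [norm_cl_rpow hpt, norm_cl_rpow hpt]
    refine h1.trans (le_of_eq ?_)
    congr 2 with θ
    have : ‖trig c θ‖ = (trig c θ).re := by
      rw [← abs_re_eq_norm.2 (him θ), abs_of_pos (hre θ)]
    rw [hsre, this]
  have h3 : ‖cl p S‖ ≤ A ^ r⁻¹ * ‖cl p (trig c)‖ := by
    rw [← Real.rpow_le_rpow_iff (norm_nonneg _) (by positivity) hr0,
      Real.mul_rpow (by positivity) (norm_nonneg _), ← Real.rpow_mul hA,
      inv_mul_cancel₀ hr0.ne', Real.rpow_one]
    exact h2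
  have h4 : trig (cut c) = (1 / 2 : ℂ) • (S + trig (Finsupp.single 0 (c 0))) := by
    ext θ
    rw [trig_single]
    simp [S, hs1]
  have h5 : ‖cl p (trig (Finsupp.single 0 (c 0)))‖ ≤ ‖cl p (trig c)‖ := by
    refine (norm_cl_le _).trans ?_
    rw [trig_single, norm_smul, fourier_norm, mul_one]
    exact norm_coeff_le_trig c 0
  rw [h4, map_smul, map_add, norm_smul]
  have h6 := norm_add_le (cl p S) (cl p (trig (Finsupp.single 0 (c 0))))
  have h7 : ‖(1 / 2 : ℂ)‖ = 1 / 2 := by simp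
  rw [h7]
  linarith

/-- Parseval: discarding coefficients cannot increase the `L²` norm. -/
lemma norm_cut_le_two (c : ℤ →₀ ℂ) : ‖cl 2 (trig (cut c))‖ ≤ ‖cl 2 (trig c)‖ := by
  have h : ∀ f : C(Torus, ℂ), HasSum (fun n => ‖fourierCoeff f n‖ ^ 2) (‖cl 2 f‖ ^ 2) := fun f => by
    have h1 := hasSum_sq_fourierCoeff (cl 2 f)
    simp_rw [fourierCoeff_cl] at h1
    convert h1 using 1
    have h2 := norm_cl_rpow (p := 2) (by simp) f
    simp only [ENNReal.toReal_ofNat, Real.rpow_ofNat] at h2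
    rw [h2]
    refine integral_congr_ae ?_
    filter_upwards [coeFn_cl (p := 2) f] with θ hθ
    rw [hθ]
  refine (sq_le_sq₀ (norm_nonneg _) (norm_nonneg _)).1 ?_
  refine hasSum_le (fun n => ?_) (h _) (h _)
  rw [fourierCoeff_trig, fourierCoeff_trig, cut_apply]
  split_ifs
  · exact le_rfl
  · simp

lemma exists_real_trig (u : C(Torus, ℝ)) {ε : ℝ} (hε : 0 < ε) :
    ∃ c : ℤ →₀ ℂ, (∀ θ, (trig c θ).im = 0) ∧ ∀ θ, |(trig c θ).re - u θ| < ε := by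
  obtain ⟨c, hc⟩ := dense_range_trig.exists_dist_lt
    (⟨fun θ => (u θ : ℂ), by fun_prop⟩ : C(Torus, ℂ)) hε
  have key : ∀ θ, trig ((1 / 2 : ℂ) • (c + conjCoeff c)) θ = ((trig c θ).re : ℂ) := fun θ => by
    rw [map_smul, map_add, ContinuousMap.smul_apply, ContinuousMap.add_apply, trig_conjCoeff,
      add_conj]
    simp
  refine ⟨(1 / 2 : ℂ) • (c + conjCoeff c), fun θ => by rw [key]; simp, fun θ => ?_⟩
  rw [key, ofReal_re]
  have h1 := (ContinuousMap.dist_apply_le_dist θ).trans_lt hc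
  rw [dist_comm, dist_eq_norm] at h1
  refine lt_of_le_of_lt ?_ h1
  have := abs_re_le_norm (trig c θ - (u θ : ℂ))
  simpa using this

/-- The positive and negative parts, raised by `ε`, are uniformly approximated by positive
trigonometric polynomials `d` and `e`. The error `c - (d - e)` is uniformly small, and its analytic
part is controlled in `L²`, which dominates `L^p` for `p ≤ 2`. -/
lemma cut_bound_of_real (hp1 : 1 < p) (hp2 : p ≤ 2) :
    ∃ C : ℝ, 0 ≤ C ∧ ∀ c : ℤ →₀ ℂ, (∀ θ, (trig c θ).im = 0) →
      ‖cl p (trig (cut c))‖ ≤ C * ‖cl p (trig c)‖ := by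
  obtain ⟨C, hC, h⟩ := cut_bound_of_pos hp1 hp2
  refine ⟨2 * C, by positivity, fun c him => ?_⟩
  have hpos : ∀ u : C(Torus, ℝ), (∀ θ, 0 ≤ u θ) → (∀ θ, u θ ≤ ‖trig c θ‖) → ∀ ε : ℝ, 0 < ε →
      ∃ d : ℤ →₀ ℂ, (∀ θ, ‖trig d θ - (u θ + ε : ℝ)‖ ≤ ε) ∧
        ‖cl p (trig (cut d))‖ ≤ C * (‖cl p (trig c)‖ + 2 * ε) := fun u hu hu1 ε hε => by
    obtain ⟨d, hd1, hd2⟩ := exists_real_trig (u + ContinuousMap.const _ ε) hε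
    have hd3 : ∀ θ, |(trig d θ).re - (u θ + ε)| < ε := hd2
    have hd4 : ∀ θ, 0 < (trig d θ).re := fun θ => by
      have := (abs_lt.1 (hd3 θ)).1
      have := hu θ
      linarith
    have hd5 : ∀ θ, trig d θ = ((trig d θ).re : ℂ) := fun θ => Complex.ext rfl (by simp [hd1])
    refine ⟨d, fun θ => ?_, (h d hd1 hd4).trans ?_⟩
    · rw [hd5, ← ofReal_sub, norm_real]
      exact (hd3 θ).le
    · refine mul_le_mul_of_nonneg_left ?_ hC
      let N : C(Torus, ℂ) := ⟨fun θ => (‖trig c θ‖ : ℂ), by fun_prop⟩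
      have e1 : ‖cl p (trig d)‖ ≤ ‖cl p (N + ContinuousMap.const _ ((2 * ε : ℝ) : ℂ))‖ := by
        refine norm_cl_mono fun θ => ?_
        have e : (N + ContinuousMap.const _ ((2 * ε : ℝ) : ℂ) : C(Torus, ℂ)) θ =
            ((‖trig c θ‖ + 2 * ε : ℝ) : ℂ) := by simp [N]
        rw [e, hd5, norm_real, norm_real, Real.norm_of_nonneg (hd4 θ).le,
          Real.norm_of_nonneg (by positivity)]
        have := (abs_lt.1 (hd3 θ)).2
        have := hu1 θ
        linarith
      refine e1.trans ?_
      rw [map_add]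
      refine (norm_add_le _ _).trans (add_le_add ?_ ?_)
      · exact norm_cl_mono fun θ => by simp [N]
      · refine (norm_cl_le _).trans ?_
        refine (ContinuousMap.norm_le _ (by positivity)).2 fun θ => ?_
        rw [ContinuousMap.const_apply, norm_real, Real.norm_of_nonneg (by positivity)]
  refine le_of_forall_pos_le_add fun δ hδ => ?_
  -- The bounds for `d` and `e` cost `2Cε` each and the error costs `2ε`.
  set ε : ℝ := δ / (4 * C + 2) with hε
  have hε0 : 0 < ε := by positivity
  obtain ⟨d, hd1, hd2⟩ := hpos ⟨fun θ => max (trig c θ).re 0, by fun_prop⟩ (fun θ => by simp)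
    (fun θ => by
      simp only [ContinuousMap.coe_mk, sup_le_iff, norm_nonneg, and_true]
      exact re_le_norm _) ε hε0
  obtain ⟨e, he1, he2⟩ := hpos ⟨fun θ => max (-(trig c θ).re) 0, by fun_prop⟩ (fun θ => by simp)
    (fun θ => by
      simp only [ContinuousMap.coe_mk, sup_le_iff, norm_nonneg, and_true]
      exact (neg_le_abs _).trans (abs_re_le_norm _)) ε hε0
  have h3 : ‖cl p (trig (cut (c - (d - e))))‖ ≤ 2 * ε := by
    refine (norm_cl_le_of_le hp2 _).trans ((norm_cut_le_two _).trans ((norm_cl_le _).trans ?_))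
    refine (ContinuousMap.norm_le _ (by positivity)).2 fun θ => ?_
    have hc : trig c θ = ((max (trig c θ).re 0 + ε : ℝ) : ℂ) -
        ((max (-(trig c θ).re) 0 + ε : ℝ) : ℂ) := by
      rw [← ofReal_sub]
      refine Complex.ext ?_ (by simp [him])
      rw [ofReal_re]
      rcases le_total 0 (trig c θ).re with hh | hh
      · rw [max_eq_left hh, max_eq_right (by linarith)]; ring
      · rw [max_eq_right hh, max_eq_left (by linarith)]; ring
    have e1 : trig (c - (d - e)) θ =
        -(trig d θ - ((max (trig c θ).re 0 + ε : ℝ) : ℂ)) +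
          (trig e θ - ((max (-(trig c θ).re) 0 + ε : ℝ) : ℂ)) := by
      rw [map_sub, map_sub, ContinuousMap.sub_apply, ContinuousMap.sub_apply]
      linear_combination hc
    rw [e1]
    refine (norm_add_le _ _).trans ?_
    rw [norm_neg]
    have := hd1 θ
    have := he1 θ
    simp only [ContinuousMap.coe_mk] at *
    linarith
  have h4 : cl p (trig (cut c)) = cl p (trig (cut (c - (d - e)))) +
      (cl p (trig (cut d)) - cl p (trig (cut e))) := by
    simp only [map_sub]; abel
  rw [h4]
  have h5 := norm_add_le (cl p (trig (cut (c - (d - e)))))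
    (cl p (trig (cut d)) - cl p (trig (cut e)))
  have h6 := norm_sub_le (cl p (trig (cut d))) (cl p (trig (cut e)))
  have h7 : (4 * C + 2) * ε = δ := by rw [hε]; field_simp
  linarith

lemma cut_bound_of_le_two (hp1 : 1 < p) (hp2 : p ≤ 2) :
    ∃ C : ℝ, 0 ≤ C ∧ ∀ c : ℤ →₀ ℂ, ‖cl p (trig (cut c))‖ ≤ C * ‖cl p (trig c)‖ := by
  obtain ⟨C, hC, h⟩ := cut_bound_of_real hp1 hp2
  refine ⟨2 * C, by positivity, fun c => ?_⟩
  set d : ℤ →₀ ℂ := (1 / 2 : ℂ) • (c + conjCoeff c) with hd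
  set e : ℤ →₀ ℂ := (-I / 2) • (c - conjCoeff c) with he
  have h1 : ∀ θ, trig d θ = ((trig c θ).re : ℂ) := fun θ => by
    rw [hd, map_smul, map_add, ContinuousMap.smul_apply, ContinuousMap.add_apply, trig_conjCoeff,
      add_conj]
    simp
  have h2 : ∀ θ, trig e θ = ((trig c θ).im : ℂ) := fun θ => by
    rw [he, map_smul, map_sub, ContinuousMap.smul_apply, ContinuousMap.sub_apply, trig_conjCoeff,
      sub_conj, smul_eq_mul]
    push_cast
    linear_combination -(trig c θ).im * I_mul_I
  have h3 : c = d + I • e := trig_injective <| ContinuousMap.ext fun θ => by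
    rw [map_add, map_smul _ I, ContinuousMap.add_apply, ContinuousMap.smul_apply, h1, h2, smul_eq_mul,
      mul_comm I, re_add_im]
  have h4 : ‖cl p (trig (cut d))‖ ≤ C * ‖cl p (trig c)‖ :=
    (h d fun θ => by rw [h1, ofReal_im]).trans <| mul_le_mul_of_nonneg_left
      (norm_cl_mono fun θ => by rw [h1, norm_real]; exact abs_re_le_norm _) hC
  have h5 : ‖cl p (trig (cut e))‖ ≤ C * ‖cl p (trig c)‖ :=
    (h e fun θ => by rw [h2, ofReal_im]).trans <| mul_le_mul_of_nonneg_left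
      (norm_cl_mono fun θ => by rw [h2, norm_real]; exact abs_im_le_norm _) hC
  have h6 : cl p (trig (cut c)) = cl p (trig (cut d)) + I • cl p (trig (cut e)) := by
    conv_lhs => rw [h3]
    simp only [map_add, map_smul]
  rw [h6]
  refine (norm_add_le _ _).trans ?_
  rw [norm_smul, norm_I]
  linarith

end

/-! ### The M. Riesz theorem for all exponents, by duality and extension. -/

section

variable {p : ℝ≥0∞} [Fact (1 ≤ p)]

lemma continuous_integral_cont : Continuous fun f : C(Torus, ℂ) => ∫ θ, f θ ∂arc := by
  have h := (continuous_integral (μ := arc) (G := ℂ)).comp (cl 1).continuous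
  exact h.congr fun f => integral_congr_ae (coeFn_cl f)

lemma norm_integral_mul_conj_le {q : ℝ≥0∞} [Fact (1 ≤ q)] (hp : p ≠ ∞) (hq : q ≠ ∞)
    (hpq : p.toReal.HolderConjugate q.toReal) (f g : C(Torus, ℂ)) :
    ‖∫ θ, f θ * conj (g θ) ∂arc‖ ≤ ‖cl p f‖ * ‖cl q g‖ := by
  have h := integral_mul_norm_le_Lp_mul_Lq (μ := arc) (f := f) (g := g) hpq
    (by rw [ENNReal.ofReal_toReal hp]; exact ContinuousMap.memLp arc ℂ f)
    (by rw [ENNReal.ofReal_toReal hq]; exact ContinuousMap.memLp arc ℂ g)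
  rw [← norm_cl_rpow hp, ← norm_cl_rpow hq, ← Real.rpow_mul (norm_nonneg _),
    ← Real.rpow_mul (norm_nonneg _), mul_one_div_cancel hpq.pos.ne',
    mul_one_div_cancel hpq.symm.pos.ne', Real.rpow_one, Real.rpow_one] at h
  refine (norm_integral_le_integral_norm _).trans (le_trans (le_of_eq ?_) h)
  simp

/-- Cutting is an orthogonal projection in `L²`, hence self-adjoint. -/
lemma integral_trig_cut (c d : ℤ →₀ ℂ) :
    ∫ θ, trig (cut c) θ * conj (trig d θ) ∂arc = ∫ θ, trig c θ * conj (trig (cut d) θ) ∂arc := by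
  have hi : ∀ f g : C(Torus, ℂ), Integrable (fun θ => f θ * conj (g θ)) arc := fun f g =>
    integrable_cont (by fun_prop)
  have hmono : ∀ (f : C(Torus, ℂ)) (n : ℤ) (a : ℂ),
      ∫ θ, f θ * conj (trig (Finsupp.single n a) θ) ∂arc = conj a * fourierCoeff f n := by
    intro f n a
    rw [fourierCoeff, ← integral_const_mul]
    refine integral_congr_ae (.of_forall fun θ => ?_)
    simp only [trig_single, ContinuousMap.smul_apply, smul_eq_mul, map_mul, fourier_neg]
    ring
  induction d using Finsupp.induction_linear with
  | zero => simp
  | add d e hd he =>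
    simp only [map_add, ContinuousMap.add_apply, mul_add]
    rw [integral_add (hi _ _) (hi _ _), integral_add (hi _ _) (hi _ _), hd, he]
  | single n a =>
    rw [hmono, fourierCoeff_trig, cut_apply]
    by_cases hn : 0 ≤ n
    · have : cut (Finsupp.single n a) = Finsupp.single n a := Finsupp.filter_single_of_pos _ hn
      rw [this, hmono, fourierCoeff_trig, if_pos hn]
    · have : cut (Finsupp.single n a) = 0 := Finsupp.filter_single_of_neg _ hn
      rw [this, if_neg hn]
      simp

/-- The theorem of M. Riesz for trigonometric polynomials. -/
lemma cut_bound (hp1 : 1 < p) (hp : p ≠ ∞) :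
    ∃ C : ℝ, ∀ c : ℤ →₀ ℂ, ‖cl p (trig (cut c))‖ ≤ C * ‖cl p (trig c)‖ := by
  rcases le_total p 2 with hp2 | hp2
  · obtain ⟨C, -, h⟩ := cut_bound_of_le_two hp1 hp2
    exact ⟨C, h⟩
  set r := p.toReal with hr
  have hr2 : 2 ≤ r := by
    have := (ENNReal.toReal_le_toReal (by simp) hp).2 hp2
    simpa using this
  have hconj := Real.HolderConjugate.conjExponent (show 1 < r by linarith)
  set s := r.conjExponent with hs
  have hs1 : 1 < s := hconj.symm.lt
  have hs2 : s ≤ 2 := by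
    rw [hs, Real.conjExponent, div_le_iff₀ (by linarith)]; linarith
  set q : ℝ≥0∞ := ENNReal.ofReal s with hq
  have hq1 : 1 < q := by
    rw [hq, ← ENNReal.ofReal_one]; exact (ENNReal.ofReal_lt_ofReal_iff (by linarith)).2 hs1
  have hq2 : q ≤ 2 := by
    rw [hq, ← ENNReal.ofReal_ofNat]; exact ENNReal.ofReal_le_ofReal hs2
  have hqr : q.toReal = s := ENNReal.toReal_ofReal (by linarith)
  have hqt : q ≠ ∞ := ENNReal.ofReal_ne_top
  have : Fact (1 ≤ q) := ⟨hq1.le⟩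
  obtain ⟨C, hC, hb⟩ := cut_bound_of_le_two hq1 hq2
  have hpq : p.toReal.HolderConjugate q.toReal := by rw [hqr]; exact hconj
  refine ⟨C, fun c => ?_⟩
  -- For a trigonometric polynomial `k` the cut moves onto `k`, where the bound for the conjugate
  -- exponent `q ≤ 2` and Hölder apply; density gives every continuous `k`.
  have key : ∀ k : C(Torus, ℂ), ‖∫ θ, trig (cut c) θ * conj (k θ) ∂arc‖ ≤
      C * ‖cl p (trig c)‖ * ‖cl q k‖ := fun k => by
    have hcont : Continuous fun k : C(Torus, ℂ) => ∫ θ, trig (cut c) θ * conj (k θ) ∂arc := by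
      have h1 := continuous_integral_cont.comp
        ((continuous_const (y := trig (cut c))).mul (continuous_star (R := C(Torus, ℂ))))
      exact h1
    refine dense_range_trig.induction_on (p := fun k : C(Torus, ℂ) =>
      ‖∫ θ, trig (cut c) θ * conj (k θ) ∂arc‖ ≤ C * ‖cl p (trig c)‖ * ‖cl q k‖) k
      (isClosed_le hcont.norm (by fun_prop)) fun d => ?_
    rw [integral_trig_cut]
    refine (norm_integral_mul_conj_le hp hqt hpq _ _).trans ?_
    have := mul_le_mul_of_nonneg_left (hb d) (norm_nonneg (cl p (trig c)))
    linarith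
  set h := trig (cut c) with hh
  -- The extremal function for Hölder's inequality; it is continuous because `r ≥ 2`.
  let k : C(Torus, ℂ) := ⟨fun θ => ((‖h θ‖ ^ (r - 2) : ℝ) : ℂ) * h θ, by
    refine (continuous_ofReal.comp ?_).mul h.continuous
    exact h.continuous.norm.rpow_const fun _ => Or.inr (by linarith)⟩
  have hk1 : ∀ θ, h θ * conj (k θ) = ((‖h θ‖ ^ r : ℝ) : ℂ) := fun θ => by
    have e : ‖h θ‖ ^ r = ‖h θ‖ ^ (r - 2) * ‖h θ‖ ^ 2 := by
      rw [← Real.rpow_natCast, ← Real.rpow_add_of_nonneg (norm_nonneg _) (by linarith) (by simp)]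
      norm_num
    simp only [k, ContinuousMap.coe_mk, map_mul, conj_ofReal]
    rw [mul_left_comm, mul_conj, normSq_eq_norm_sq, e]
    push_cast
    ring
  have hk2 : ∀ θ, ‖k θ‖ ^ s = ‖h θ‖ ^ r := fun θ => by
    have e : ‖k θ‖ = ‖h θ‖ ^ (r - 1) := by
      simp only [k, ContinuousMap.coe_mk, norm_mul, norm_real]
      rw [Real.norm_of_nonneg (by positivity)]
      nth_rewrite 2 [← Real.rpow_one ‖h θ‖]
      rw [← Real.rpow_add_of_nonneg (norm_nonneg _) (by linarith) zero_le_one]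
      ring_nf
    rw [e, ← Real.rpow_mul (norm_nonneg _), hconj.sub_one_mul_conj]
  have hk3 : ‖cl q k‖ ^ s = ‖cl p h‖ ^ r := by
    rw [norm_cl_rpow hp, ← hqr, norm_cl_rpow hqt, hqr]
    simp_rw [hk2]
    rfl
  have hk4 : ∫ θ, h θ * conj (k θ) ∂arc = ((‖cl p h‖ ^ r : ℝ) : ℂ) := by
    simp_rw [hk1]
    rw [integral_complex_ofReal, norm_cl_rpow hp]
  have h5 := key k
  rw [hk4, norm_real, Real.norm_of_nonneg (by positivity)] at h5
  have hs0 : 0 < s := by linarith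
  have hk5 : ‖cl q k‖ = ‖cl p h‖ ^ (r - 1) := by
    rw [← Real.rpow_left_inj (norm_nonneg _) (by positivity) hs0.ne', hk3,
      ← Real.rpow_mul (norm_nonneg _), hconj.sub_one_mul_conj]
  rcases eq_or_lt_of_le (norm_nonneg (cl p h)) with h0 | h0
  · rw [← h0]; positivity
  · have e : ‖cl p h‖ ^ r = ‖cl p h‖ * ‖cl p h‖ ^ (r - 1) := by
      nth_rewrite 2 [← Real.rpow_one ‖cl p h‖]
      rw [← Real.rpow_add h0]; ring_nf
    rw [hk5, e] at h5
    exact le_of_mul_le_mul_right h5 (Real.rpow_pos_of_pos h0 _)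

lemma exists_riesz_projection (hp1 : 1 < p) (hp : p ≠ ∞) :
    ∃ P : LpT p →L[ℂ] LpT p, ∀ (f : LpT p) (n : ℤ),
      fourierCoeff (P f) n = if 0 ≤ n then fourierCoeff f n else 0 := by
  obtain ⟨C, hC⟩ := cut_bound hp1 hp
  set e : (ℤ →₀ ℂ) →ₗ[ℂ] LpT p := (cl p).toLinearMap ∘ₗ trig with he
  set g : (ℤ →₀ ℂ) →ₗ[ℂ] LpT p := (cl p).toLinearMap ∘ₗ trig ∘ₗ cut with hg
  have hd : DenseRange e := dense_range_cl_trig hp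
  refine ⟨g.extendOfNorm e, fun f n => ?_⟩
  rw [← coeffL_apply, ← coeffL_apply]
  refine hd.induction_on (p := fun f => coeffL p n (g.extendOfNorm e f) =
    if 0 ≤ n then coeffL p n f else 0) f (isClosed_eq (by fun_prop) ?_) fun c => ?_
  · split_ifs
    · fun_prop
    · exact continuous_const
  · rw [LinearMap.extendOfNorm_eq hd ⟨C, hC⟩]
    change coeffL p n (cl p (trig (cut c))) = if 0 ≤ n then coeffL p n (cl p (trig c)) else 0
    rw [coeffL_cl, coeffL_cl, fourierCoeff_trig, fourierCoeff_trig, cut_apply]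

lemma coeffL_rieszP (hp1 : 1 < p) (hp : p ≠ ∞) (f : LpT p) (n : ℤ) :
    coeffL p n (rieszP p f) = if 0 ≤ n then coeffL p n f else 0 := by
  have h := exists_riesz_projection hp1 hp
  rw [rieszP, dif_pos h]
  exact h.choose_spec f n

end

/-! ## A nonzero function with one-sided spectrum vanishes almost nowhere -/

/-- Jensen's inequality, from the bound of the constant coefficient by the Mahler measure. The shift
by `ε` makes the right side stable under `L¹` approximation. -/
lemma log_norm_eval_zero_le (q : Polynomial ℂ) (hq : q.eval 0 ≠ 0) {ε : ℝ} (hε : 0 < ε) :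
    Real.log ‖q.eval 0‖ ≤ ∫ θ, Real.log (‖q.eval (pt θ)‖ + ε) ∂arc := by
  have hq0 : q ≠ 0 := by rintro rfl; simp at hq
  have h1 : ‖q.eval 0‖ ≤ q.mahlerMeasure := by
    have := Polynomial.norm_coeff_le_choose_mul_mahlerMeasure 0 q
    simpa [Polynomial.coeff_zero_eq_eval_zero] using this
  have h2 : Real.log ‖q.eval 0‖ ≤ Real.circleAverage (fun z => Real.log ‖q.eval z‖) 0 1 := by
    rw [← Polynomial.logMahlerMeasure_def, Polynomial.logMahlerMeasure_eq_log_MahlerMeasure]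
    exact Real.log_le_log (norm_pos_iff.2 hq) h1
  classical
  -- At a zero of `q` the convention `log 0 = 0` could exceed `log ε`. Changing these finitely many
  -- values does not affect the circle average.
  set g : ℂ → ℝ := fun z => if q.eval z = 0 then Real.log ε else Real.log ‖q.eval z‖ with hg
  have hfg : (fun z => Real.log ‖q.eval z‖) =ᶠ[Filter.codiscreteWithin (Metric.sphere 0 |1|)] g := by
    have hfin : {z | q.eval z = 0}.Finite := by
      refine (q.roots.toFinset.finite_toSet).subset fun z hz => ?_
      simpa [hq0] using hz
    filter_upwards [compl_finite_mem_codiscreteWithin hfin] with z hz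
    have : q.eval z ≠ 0 := hz
    simp [hg, this]
  have hint : CircleIntegrable (fun z => Real.log ‖q.eval z‖) 0 1 :=
    q.intervalIntegrable_mahlerMeasure
  have hpos : ∀ z, 0 < ‖q.eval z‖ + ε := fun z => by positivity
  have hint2 : CircleIntegrable (fun z => Real.log (‖q.eval z‖ + ε)) 0 1 := by
    refine Continuous.intervalIntegrable ?_ _ _
    refine Continuous.log ?_ fun x => (hpos _).ne'
    exact ((q.continuous.comp (continuous_circleMap 0 1)).norm).add continuous_const
  rw [integral_pt_eq_circleAverage fun z => Real.log (‖q.eval z‖ + ε)]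
  refine h2.trans ?_
  rw [Real.circleAverage_congr_codiscreteWithin hfg one_ne_zero]
  refine Real.circleAverage_mono (hint.congr_codiscreteWithin hfg) hint2 fun z _ => ?_
  simp only [hg]
  split_ifs with h
  · simp [h]
  · exact Real.log_le_log (norm_pos_iff.2 h) (by linarith)

/-- On `[0, ∞)` the function `log (· + ε)` is Lipschitz with constant `1/ε`. -/
lemma log_add_le {x y ε : ℝ} (hx : 0 ≤ x) (hy : 0 ≤ y) (hε : 0 < ε) :
    Real.log (x + ε) ≤ Real.log (y + ε) + |x - y| / ε := by
  have h1 : 0 < x + ε := by positivity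
  have h2 : 0 < y + ε := by positivity
  have h3 := Real.log_le_sub_one_of_pos (div_pos h1 h2)
  rw [Real.log_div h1.ne' h2.ne'] at h3
  have h4 : (x + ε) / (y + ε) - 1 = (x - y) / (y + ε) := by field_simp; ring
  have h5 : (x - y) / (y + ε) ≤ |x - y| / ε := by
    refine (div_le_div_of_nonneg_right (le_abs_self _) h2.le).trans ?_
    exact div_le_div_of_nonneg_left (abs_nonneg _) hε (by linarith)
  linarith

section

variable {p : ℝ≥0∞} [Fact (1 ≤ p)]

lemma integral_norm_le (f : LpT p) : ∫ θ, ‖f θ‖ ∂arc ≤ ‖f‖ := by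
  rw [integral_norm_eq_lintegral_enorm (integrable_coe p f).1, Lp.norm_def,
    ← eLpNorm_one_eq_lintegral_enorm]
  exact ENNReal.toReal_mono (Lp.memLp f).2.ne
    (eLpNorm_le_eLpNorm_of_exponent_le Fact.out (integrable_coe p f).1)

lemma rieszP_cl_trig (hp1 : 1 < p) (hp : p ≠ ∞) (c : ℤ →₀ ℂ) :
    rieszP p (cl p (trig c)) = cl p (trig (cut c)) := by
  refine ext_coeff fun n => ?_
  rw [coeffL_rieszP hp1 hp, coeffL_cl, coeffL_cl, fourierCoeff_trig, fourierCoeff_trig, cut_apply]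

/-- After removal of its constant term, `f` is fixed by the bounded projection `Q`. Applying `Q` to
an arbitrary approximation therefore gives one with the right spectrum, and the constant term is
restored exactly. -/
lemma exists_trig_near (hp1 : 1 < p) (hp : p ≠ ∞) {f : LpT p} (hf : ∀ n, 0 < n → coeffL p n f = 0)
    {δ : ℝ} (hδ : 0 < δ) :
    ∃ c : ℤ →₀ ℂ, (∀ n, 0 < n → c n = 0) ∧ c 0 = coeffL p 0 f ∧ ‖f - cl p (trig c)‖ < δ := by
  set a := coeffL p 0 f with ha
  set Q : LpT p →L[ℂ] LpT p := rieszQ p with hQ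
  set x : LpT p := cl p (trig (Finsupp.single 0 a)) with hx
  have hxn : ∀ n, coeffL p n x = Finsupp.single 0 a n := fun n => by
    rw [hx, coeffL_cl, fourierCoeff_trig]
  have hQf : Q (f - x) = f - x := by
    have : rieszP p (f - x) = 0 := by
      refine ext_coeff fun n => ?_
      rw [coeffL_rieszP hp1 hp, map_sub, hxn, map_zero]
      split_ifs with h
      · rcases h.eq_or_lt with rfl | h
        · simp [ha]
        · rw [hf n h, Finsupp.single_apply, if_neg h.ne, sub_zero]
      · rfl
    rw [hQ, rieszQ, _root_.sub_apply, this, sub_zero]; rfl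
  have hδ' : 0 < δ / (‖Q‖ + 1) := by positivity
  obtain ⟨d, hd⟩ := (dense_range_cl_trig (p := p) hp).exists_dist_lt (f - x) hδ'
  refine ⟨Finsupp.single 0 a + (d - cut d), fun n hn => ?_, ?_, ?_⟩
  · simp [cut_apply, hn.le, hn.ne]
  · simp [cut_apply]
  · have e : f - cl p (trig (Finsupp.single 0 a + (d - cut d))) =
        Q ((f - x) - cl p (trig d)) := by
      rw [map_sub Q, hQf, map_add, map_add, ← hx, hQ, rieszQ, _root_.sub_apply,
        rieszP_cl_trig hp1 hp, map_sub, map_sub]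
      simp only [ContinuousLinearMap.coe_id', id_eq]
      abel
    rw [e]
    refine (Q.le_opNorm _).trans_lt ?_
    rw [dist_eq_norm] at hd
    have hd' : ‖f - x - cl p (trig d)‖ < δ / (‖Q‖ + 1) := hd
    rw [lt_div_iff₀ (by positivity)] at hd'
    have := norm_nonneg (f - x - cl p (trig d))
    nlinarith

lemma integrable_log_norm_add {g : Torus → ℂ} (hg : Integrable g arc) {ε : ℝ} (hε : 0 < ε) :
    Integrable (fun θ => Real.log (‖g θ‖ + ε)) arc := by
  refine ((hg.norm.div_const ε).add (integrable_const |Real.log ε|)).mono' ?_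
    (.of_forall fun θ => ?_)
  · exact (Real.measurable_log.comp_aemeasurable
      (hg.1.norm.aemeasurable.add_const ε)).aestronglyMeasurable
  · have h1 := log_add_le (norm_nonneg (g θ)) le_rfl hε
    have h2 : Real.log ε ≤ Real.log (‖g θ‖ + ε) :=
      Real.log_le_log hε (by have := norm_nonneg (g θ); linarith)
    simp only [zero_add, sub_zero, abs_norm] at h1
    rw [Real.norm_eq_abs, abs_le, Pi.add_apply]
    have h3 := neg_abs_le (Real.log ε)
    have h4 := le_abs_self (Real.log ε)
    have h5 : 0 ≤ ‖g θ‖ / ε := by positivity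
    constructor <;> linarith

/-- The conjugate of the approximating trigonometric polynomial is an analytic polynomial with the
same modulus, so Jensen's inequality passes to `f` in the limit. -/
lemma log_norm_coeff_le (hp1 : 1 < p) (hp : p ≠ ∞) {f : LpT p}
    (hf : ∀ n, 0 < n → coeffL p n f = 0) (h0 : coeffL p 0 f ≠ 0) {ε : ℝ} (hε : 0 < ε) :
    Real.log ‖coeffL p 0 f‖ ≤ ∫ θ, Real.log (‖f θ‖ + ε) ∂arc := by
  refine le_of_forall_pos_le_add fun δ hδ => ?_
  obtain ⟨c, hc1, hc2, hc3⟩ := exists_trig_near hp1 hp hf (mul_pos hδ hε)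
  obtain ⟨q, hq1, hq2⟩ := exists_polynomial (conjCoeff c)
  have hcut : cut (conjCoeff c) = conjCoeff c := by
    ext n
    rw [cut_apply, conjCoeff_apply]
    split_ifs with h
    · rfl
    · rw [hc1 _ (by omega), map_zero]
  have hqn : ∀ θ, ‖q.eval (pt θ)‖ = ‖trig c θ‖ := fun θ => by
    rw [hq1, hcut, trig_conjCoeff, norm_conj]
  have hq0 : ‖q.eval 0‖ = ‖coeffL p 0 f‖ := by
    rw [hq2, conjCoeff_apply, norm_conj, neg_zero, hc2]
  have h1 := log_norm_eval_zero_le q (by rw [← norm_pos_iff, hq0]; exact norm_pos_iff.2 h0) hε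
  rw [hq0] at h1
  simp_rw [hqn] at h1
  refine h1.trans ?_
  have i1 := integrable_log_norm_add (integrable_cont (trig c).continuous) hε
  have i2 := integrable_log_norm_add (integrable_coe p f) hε
  have i3 : Integrable (fun θ => ‖(f - cl p (trig c) : LpT p) θ‖ / ε) arc :=
    (integrable_coe p _).norm.div_const ε
  calc ∫ θ, Real.log (‖trig c θ‖ + ε) ∂arc
      ≤ ∫ θ, (Real.log (‖f θ‖ + ε) + ‖(f - cl p (trig c) : LpT p) θ‖ / ε) ∂arc := by
        refine integral_mono_ae i1 (i2.add i3) ?_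
        filter_upwards [Lp.coeFn_sub f (cl p (trig c)), coeFn_cl (p := p) (trig c)] with θ e1 e2
        rw [e1, Pi.sub_apply, e2]
        refine (log_add_le (norm_nonneg _) (norm_nonneg (f θ)) hε).trans ?_
        gcongr
        rw [abs_sub_comm]
        exact abs_norm_sub_norm_le _ _
    _ = ∫ θ, Real.log (‖f θ‖ + ε) ∂arc + (∫ θ, ‖(f - cl p (trig c) : LpT p) θ‖ ∂arc) / ε := by
        rw [integral_add i2 i3, integral_div]
    _ ≤ _ := by
        gcongr
        rw [div_le_iff₀ hε]
        exact (integral_norm_le _).trans hc3.le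

lemma ae_ne_zero_of_coeff_zero_ne_zero (hp1 : 1 < p) (hp : p ≠ ∞) {f : LpT p}
    (hf : ∀ n, 0 < n → coeffL p n f = 0) (h0 : coeffL p 0 f ≠ 0) : ∀ᵐ θ ∂arc, f θ ≠ 0 := by
  set E : Set Torus := {θ | f θ = 0} with hE
  have hEm : MeasurableSet E :=
    (Lp.stronglyMeasurable f).measurable (measurableSet_singleton 0)
  by_contra hne
  have hE0 : 0 < arc.real E := by
    refine measureReal_nonneg.lt_of_ne' fun h => hne ?_
    rw [measureReal_eq_zero_iff] at h
    rw [ae_iff]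
    simpa using h
  -- With `ε = exp (-M)` the logarithm equals `-M` on `E` and is at most `‖f θ‖` off `E`. This `M`
  -- pushes the integral below `log ‖coeffL p 0 f‖`, contradicting Jensen.
  set M : ℝ := (‖f‖ + |Real.log ‖coeffL p 0 f‖| + 1) / arc.real E with hM
  have hM0 : 0 < M := by positivity
  have h1 := log_norm_coeff_le hp1 hp hf h0 (Real.exp_pos (-M))
  have h2 : ∫ θ, Real.log (‖f θ‖ + Real.exp (-M)) ∂arc ≤
      ∫ θ, (‖f θ‖ + E.indicator (fun _ => -M) θ) ∂arc := by
    refine integral_mono (integrable_log_norm_add (integrable_coe p f) (Real.exp_pos _))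
      ((integrable_coe p f).norm.add ((integrable_const _).indicator hEm)) fun θ => ?_
    by_cases hθ : θ ∈ E
    · have : f θ = 0 := hθ
      simp [this, hθ]
    · have h3 : Real.exp (-M) ≤ 1 := Real.exp_le_one_iff.2 (by linarith)
      have h4 := Real.log_le_sub_one_of_pos
        (show 0 < ‖f θ‖ + Real.exp (-M) from add_pos_of_nonneg_of_pos (norm_nonneg _)
          (Real.exp_pos _))
      simp only [Set.indicator_of_notMem hθ]
      linarith
  rw [integral_add (integrable_coe p f).norm ((integrable_const _).indicator hEm),
    integral_indicator_const _ hEm, smul_eq_mul] at h2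
  have h3 := integral_norm_le f
  have h4 : arc.real E * M = ‖f‖ + |Real.log ‖coeffL p 0 f‖| + 1 := by
    rw [hM]; field_simp
  have h5 := neg_abs_le (Real.log ‖coeffL p 0 f‖)
  linarith

/-! ## Multiplication operators -/

lemma coeFn_mulOp (a : Linf) (f : LpT p) : mulOp p a f =ᵐ[arc] fun θ => a θ * f θ :=
  (ContinuousLinearMap.mul ℂ ℂ).coeFn_holder a f

lemma coeFn_ofCont (s : C(Torus, ℂ)) : ofCont s =ᵐ[arc] s := ContinuousMap.coeFn_toLp arc s

/-- Multiplication by a continuous function on `L^p`. -/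
abbrev mulC (p : ℝ≥0∞) [Fact (1 ≤ p)] (s : C(Torus, ℂ)) : LpT p →L[ℂ] LpT p := mulOp p (ofCont s)

lemma coeFn_mulC (s : C(Torus, ℂ)) (f : LpT p) : mulC p s f =ᵐ[arc] fun θ => s θ * f θ := by
  filter_upwards [coeFn_mulOp (ofCont s) f, coeFn_ofCont s] with θ h1 h2
  rw [h1, h2]

lemma mulC_mulC (s t : C(Torus, ℂ)) (f : LpT p) : mulC p s (mulC p t f) = mulC p (s * t) f := by
  refine Lp.ext ?_
  filter_upwards [coeFn_mulC s (mulC p t f), coeFn_mulC t f, coeFn_mulC (s * t) f] with θ h1 h2 h3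
  rw [h1, h2, h3, ContinuousMap.mul_apply, mul_assoc]

lemma mulC_mulOp (s : C(Torus, ℂ)) (a : Linf) (f : LpT p) :
    mulC p s (mulOp p a f) = mulOp p a (mulC p s f) := by
  refine Lp.ext ?_
  filter_upwards [coeFn_mulC s (mulOp p a f), coeFn_mulC s f, coeFn_mulOp a f,
    coeFn_mulOp a (mulC p s f)] with θ h1 h2 h3 h4
  rw [h1, h3, h4, h2]; ring

lemma mulOp_mulInf (a b : Linf) (f : LpT p) : mulOp p (mulInf a b) f = mulOp p a (mulOp p b f) := by
  refine Lp.ext ?_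
  filter_upwards [coeFn_mulOp (mulInf a b) f, coeFn_mulOp a (mulOp p b f), coeFn_mulOp b f,
    (ContinuousLinearMap.mul ℂ ℂ).coeFn_holder (r := ∞) a b] with θ h1 h2 h3 h4
  rw [h1, h2, h3]
  have : (mulInf a b) θ = a θ * b θ := h4
  rw [this, mul_assoc]

lemma mulC_add (s t : C(Torus, ℂ)) (f : LpT p) : mulC p (s + t) f = mulC p s f + mulC p t f := by
  simp [mulC, mulOp, ofCont]

lemma mulC_smul (c : ℂ) (s : C(Torus, ℂ)) (f : LpT p) : mulC p (c • s) f = c • mulC p s f := by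
  simp [mulC, mulOp, ofCont]

lemma mulC_one (f : LpT p) : mulC p 1 f = f := by
  refine Lp.ext ?_
  filter_upwards [coeFn_mulC 1 f] with θ h
  rw [h, ContinuousMap.one_apply, one_mul]

lemma mulC_cl (s t : C(Torus, ℂ)) : mulC p s (cl p t) = cl p (s * t) := by
  refine Lp.ext ?_
  filter_upwards [coeFn_mulC s (cl p t), coeFn_cl (p := p) t, coeFn_cl (p := p) (s * t)]
    with θ h1 h2 h3
  rw [h1, h2, h3, ContinuousMap.mul_apply]

lemma continuous_mulC (f : LpT p) : Continuous fun s : C(Torus, ℂ) => mulC p s f := by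
  have h : Continuous fun a : Linf => mulOp p a f :=
    (((ContinuousLinearMap.mul ℂ ℂ).holderL arc ∞ p p).flip f).continuous
  exact h.comp (ContinuousMap.toLp ∞ arc ℂ).continuous

lemma coeffL_mulC_fourier (k n : ℤ) (f : LpT p) :
    coeffL p n (mulC p (fourier k) f) = coeffL p (n - k) f := by
  rw [coeffL_apply, coeffL_apply, fourierCoeff_congr_ae (coeFn_mulC (fourier k) f), fourierCoeff,
    fourierCoeff]
  refine integral_congr_ae (.of_forall fun θ => ?_)
  simp only [smul_eq_mul]
  rw [← mul_assoc, ← fourier_add]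
  congr 3
  ring

/-- A nonzero function of `L^p` whose Fourier coefficients vanish from some index on is nonzero
almost everywhere. -/
lemma ae_ne_zero_of_coeff (hp1 : 1 < p) (hp : p ≠ ∞) {f : LpT p} {m : ℤ}
    (hf : ∀ n, m ≤ n → coeffL p n f = 0) (h0 : f ≠ 0) : ∀ᵐ θ ∂arc, f θ ≠ 0 := by
  obtain ⟨n₀, hn₀⟩ : ∃ n, coeffL p n f ≠ 0 := by
    by_contra! h
    exact h0 (ext_coeff fun n => by rw [h n, map_zero])
  -- Shifting the highest nonzero coefficient to index `0` reduces to the previous case.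
  obtain ⟨k, hk, hmax⟩ := Int.exists_greatest_of_bdd (P := fun n => coeffL p n f ≠ 0)
    ⟨m, fun n hn => le_of_not_ge fun h => hn (hf n h)⟩ ⟨n₀, hn₀⟩
  have h := ae_ne_zero_of_coeff_zero_ne_zero hp1 hp (f := mulC p (fourier (-k)) f)
    (fun n hn => by
      rw [coeffL_mulC_fourier]
      by_contra h
      have := hmax _ h
      omega)
    (by rw [coeffL_mulC_fourier]; simpa using hk)
  filter_upwards [h, coeFn_mulC (fourier (-k)) f] with θ h1 h2 h3
  rw [h2, h3, mul_zero] at h1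
  exact h1 rfl

end

/-! ## The weighted shift exchanges the analytic and the antianalytic functions -/

lemma eq_zero_of_forall_eq_mul {y : ℕ → ℂ} {C : ℝ} {b : ℂ} (hb : 1 < ‖b‖) (hC : ∀ k, ‖y k‖ ≤ C)
    (h : ∀ k, y (k + 1) = b * y k) (k : ℕ) : y k = 0 := by
  have hp : ∀ j, y (k + j) = b ^ j * y k := fun j => by
    induction j with
    | zero => simp
    | succ j ih => rw [← add_assoc, h, ih, pow_succ]; ring
  by_contra hk
  have hk' : 0 < ‖y k‖ := norm_pos_iff.2 hk
  obtain ⟨j, hj⟩ := pow_unbounded_of_one_lt (C / ‖y k‖) hb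
  rw [div_lt_iff₀ hk'] at hj
  have := hC (k + j)
  rw [hp, norm_mul, norm_pow] at this
  linarith

/-- The function `t ↦ a t + b`. -/
def lin (a b : ℂ) : C(Torus, ℂ) := a • (fourier 1 : C(Torus, ℂ)) + b • 1

lemma lin_apply (a b : ℂ) (θ : Torus) : lin a b θ = a * pt θ + b := by
  simp [lin, pt]

section

variable {p : ℝ≥0∞} [Fact (1 ≤ p)]

lemma coeffL_mulC_lin (a b : ℂ) (f : LpT p) (n : ℤ) :
    coeffL p n (mulC p (lin a b) f) = a * coeffL p (n - 1) f + b * coeffL p n f := by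
  rw [lin, mulC_add, mulC_smul, mulC_smul, map_add, map_smul, map_smul, coeffL_mulC_fourier,
    mulC_one]
  rfl

lemma coeffL_const (c : ℂ) (n : ℤ) :
    coeffL p n (cl p (c • 1)) = if n = 0 then c else 0 := by
  have : (c • 1 : C(Torus, ℂ)) = trig (Finsupp.single 0 c) := by
    ext θ; simp [trig_single]
  rw [this, coeffL_cl, fourierCoeff_trig, Finsupp.single_apply]
  simp only [eq_comm]

/-- `f ∈ L^p` belongs to `ker P`. -/
def IsAnti (f : LpT p) : Prop := ∀ n, 0 ≤ n → coeffL p n f = 0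

lemma IsAnti.add {f g : LpT p} (hf : IsAnti f) (hg : IsAnti g) : IsAnti (f + g) := fun n hn => by
  rw [map_add, hf n hn, hg n hn, add_zero]

lemma IsAnti.smul {f : LpT p} (hf : IsAnti f) (c : ℂ) : IsAnti (c • f) := fun n hn => by
  rw [map_smul, hf n hn, smul_zero]

lemma IsAnti.neg {f : LpT p} (hf : IsAnti f) : IsAnti (-f) := fun n hn => by
  rw [map_neg, hf n hn, neg_zero]

lemma mem_hardy {f : LpT p} : f ∈ Hardy p ↔ ∀ n, n < 0 → coeffL p n f = 0 := Iff.rfl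

lemma eq_zero_of_isAnti_of_mem {f : LpT p} (hf : IsAnti f) (hf' : f ∈ Hardy p) : f = 0 :=
  ext_coeff fun n => by
    rw [map_zero]
    rcases lt_or_ge n 0 with h | h
    · exact hf' n h
    · exact hf n h

lemma rieszP_eq_zero_iff (hp1 : 1 < p) (hp : p ≠ ∞) {f : LpT p} : rieszP p f = 0 ↔ IsAnti f := by
  constructor
  · intro h n hn
    have := coeffL_rieszP hp1 hp f n
    rw [h, map_zero, if_pos hn] at this
    exact this.symm
  · intro h
    refine ext_coeff fun n => ?_
    rw [coeffL_rieszP hp1 hp, map_zero]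
    split_ifs with hn
    · exact h n hn
    · rfl

lemma rieszP_eq_self (hp1 : 1 < p) (hp : p ≠ ∞) {f : LpT p} (hf : f ∈ Hardy p) :
    rieszP p f = f := by
  refine ext_coeff fun n => ?_
  rw [coeffL_rieszP hp1 hp]
  split_ifs with hn
  · rfl
  · exact (hf n (not_le.1 hn)).symm

lemma rieszQ_apply (f : LpT p) : rieszQ p f = f - rieszP p f := rfl

lemma isAnti_rieszQ (hp1 : 1 < p) (hp : p ≠ ∞) (f : LpT p) : IsAnti (rieszQ p f) := fun n hn => by
  rw [rieszQ_apply, map_sub, coeffL_rieszP hp1 hp, if_pos hn, sub_self]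

lemma rieszQ_eq_self (hp1 : 1 < p) (hp : p ≠ ∞) {f : LpT p} (hf : IsAnti f) : rieszQ p f = f := by
  rw [rieszQ_apply, (rieszP_eq_zero_iff hp1 hp).2 hf, sub_zero]

lemma mulC_lin_mem_hardy (a b : ℂ) {f : LpT p} (hf : f ∈ Hardy p) :
    mulC p (lin a b) f ∈ Hardy p := mem_hardy.2 fun n hn => by
  rw [coeffL_mulC_lin, mem_hardy.1 hf n hn, mem_hardy.1 hf (n - 1) (by omega)]; simp

/-! ### Division by `β̄ t - 1` and `t - β`, and the action of `J_α`. -/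

variable {β : ℂ} (hβ : 1 < ‖β‖)
include hβ

/-- The hypothesis makes the coefficients with `n ≥ 0` geometric with ratio `β̄`. They are bounded
and `|β| > 1`, so they vanish: division by `β̄ t - 1` creates only negative frequencies. -/
lemma isAnti_of_mulC {y : LpT p}
    (h : ∀ n, 0 < n → coeffL p n (mulC p (lin (conj β) (-1)) y) = 0) : IsAnti y := fun n hn => by
  obtain ⟨k, rfl⟩ := Int.eq_ofNat_of_zero_le hn
  refine eq_zero_of_forall_eq_mul (y := fun k : ℕ => coeffL p k y) (b := conj β)
    (by rwa [norm_conj]) (fun k => norm_coeffL_le y k) (fun k => ?_) k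
  have := h (k + 1) (by omega)
  rw [coeffL_mulC_lin, add_sub_cancel_right] at this
  push_cast
  linear_combination -this

/-- The same argument run towards `-∞`, with ratio `β`. -/
lemma mem_hardy_of_mulC {y : LpT p}
    (h : mulC p (lin 1 (-β)) y ∈ Hardy p) : y ∈ Hardy p := mem_hardy.2 fun n hn => by
  obtain ⟨k, rfl⟩ : ∃ k : ℕ, n = -1 - k := ⟨(-1 - n).toNat, by omega⟩
  refine eq_zero_of_forall_eq_mul (y := fun k : ℕ => coeffL p (-1 - k) y) (b := β)
    hβ (fun k => norm_coeffL_le y _) (fun k => ?_) k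
  have := mem_hardy.1 h (-1 - k) (by omega)
  rw [coeffL_mulC_lin] at this
  have e : (-1 - ((k + 1 : ℕ) : ℤ)) = -1 - k - 1 := by push_cast; ring
  rw [e]
  linear_combination this

omit hβ in
/-- The function `α` on `𝕋`. -/
def alphaC (β : ℂ) (hβ : 1 < ‖β‖) : C(Torus, ℂ) := ⟨fun θ => alpha β (pt θ), continuous_alpha_pt β hβ⟩

/-- Multiplying `α f` by `β̄ t - 1` gives `(t - β) f`, and a linear factor raises the spectrum by at
most one. -/
lemma isAnti_mulC_alphaC {f : LpT p} (hf : IsAnti f) : IsAnti (mulC p (alphaC β hβ) f) := by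
  refine isAnti_of_mulC hβ fun n hn => ?_
  have e : lin (conj β) (-1) * alphaC β hβ = lin 1 (-β) := by
    ext θ
    have h0 := den_ne_zero hβ (norm_pt θ)
    simp only [ContinuousMap.mul_apply, lin_apply, alphaC, ContinuousMap.coe_mk, alpha]
    rw [← sub_eq_add_neg, mul_div_cancel₀ _ h0]
    ring
  rw [mulC_mulC, e, coeffL_mulC_lin, hf n hn.le, hf (n - 1) (by omega)]
  simp

lemma alpha_ne_zero (θ : Torus) : alpha β (pt θ) ≠ 0 :=
  norm_pos_iff.1 (by rw [norm_alpha hβ (norm_pt θ)]; exact one_pos)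

/-- The function `α⁻¹` on `𝕋`. -/
def alphaInvC (β : ℂ) (hβ : 1 < ‖β‖) : C(Torus, ℂ) :=
  ⟨fun θ => (alpha β (pt θ))⁻¹, (continuous_alpha_pt β hβ).inv₀ (alpha_ne_zero hβ)⟩

lemma sub_ne_zero_of_pt (θ : Torus) : pt θ - β ≠ 0 := by
  rw [sub_ne_zero]
  rintro h
  rw [← h, norm_pt] at hβ
  exact lt_irrefl _ hβ

lemma lin_mul_alphaInvC : lin 1 (-β) * alphaInvC β hβ = lin (conj β) (-1) := by
  ext θ
  have h1 := sub_ne_zero_of_pt hβ θ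
  simp only [ContinuousMap.mul_apply, lin_apply, alphaInvC, ContinuousMap.coe_mk, alpha, inv_div]
  rw [one_mul, ← sub_eq_add_neg, mul_div_cancel₀ _ h1]
  ring

lemma mulC_alphaInvC_mem_hardy {f : LpT p} (hf : f ∈ Hardy p) :
    mulC p (alphaInvC β hβ) f ∈ Hardy p := by
  refine mem_hardy_of_mulC hβ ?_
  rw [mulC_mulC, lin_mul_alphaInvC hβ]
  exact mulC_lin_mem_hardy _ _ hf

lemma weight_apply (θ : Torus) : weight β hβ θ = lam β / (conj β * pt θ - 1) := by
  have h1 := pt_ne_zero θ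
  change (pt θ)⁻¹ * alphaMinus β (pt θ) = _
  rw [alphaMinus]
  field_simp

lemma lin_mul_weight : lin (conj β) (-1) * weight β hβ = lam β • 1 := by
  ext θ
  have h0 := den_ne_zero hβ (norm_pt θ)
  rw [ContinuousMap.mul_apply, lin_apply, weight_apply, ← sub_eq_add_neg, mul_div_cancel₀ _ h0]
  simp

lemma isAnti_cl_weight : IsAnti (cl p (weight β hβ)) := by
  refine isAnti_of_mulC hβ fun n hn => ?_
  rw [mulC_cl, lin_mul_weight, coeffL_const, if_neg hn.ne']

lemma isAnti_mulC_weight {f : LpT p} (hf : IsAnti f) : IsAnti (mulC p (weight β hβ) f) := by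
  refine isAnti_of_mulC hβ fun n hn => ?_
  rw [mulC_mulC, lin_mul_weight, mulC_smul, mulC_one, map_smul, hf n hn.le, smul_zero]

lemma mulC_alphaInvC_weight_mem_hardy : cl p (alphaInvC β hβ * weight β hβ) ∈ Hardy p := by
  refine mem_hardy_of_mulC hβ ?_
  rw [mulC_cl, ← mul_assoc, lin_mul_alphaInvC, lin_mul_weight]
  exact mem_hardy.2 fun n hn => by rw [coeffL_const, if_neg hn.ne]

lemma coeFn_compShift (f : LpT p) :
    compShift p β hβ f =ᵐ[arc] fun θ => f (shift β hβ θ) := coeFn_compFun p β hβ f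

/-- The function `s ∘ α`. -/
def shiftC (β : ℂ) (hβ : 1 < ‖β‖) (s : C(Torus, ℂ)) : C(Torus, ℂ) :=
  s.comp ⟨shift β hβ, continuous_shift β hβ⟩

lemma shiftC_apply (s : C(Torus, ℂ)) (θ : Torus) : shiftC β hβ s θ = s (shift β hβ θ) := rfl

lemma shiftC_shiftC (s : C(Torus, ℂ)) : shiftC β hβ (shiftC β hβ s) = s := by
  ext θ
  rw [shiftC_apply, shiftC_apply, shift_shift]

lemma compShift_compShift (f : LpT p) : compShift p β hβ (compShift p β hβ f) = f := by
  refine Lp.ext ?_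
  filter_upwards [coeFn_compShift hβ (compShift p β hβ f),
    (quasi_shift β hβ).ae (coeFn_compShift hβ f)] with θ h1 h2
  rw [h1, h2, shift_shift]

lemma compShift_mulC (s : C(Torus, ℂ)) (f : LpT p) :
    compShift p β hβ (mulC p s f) = mulC p (shiftC β hβ s) (compShift p β hβ f) := by
  refine Lp.ext ?_
  filter_upwards [coeFn_compShift hβ (mulC p s f), (quasi_shift β hβ).ae (coeFn_mulC s f),
    coeFn_mulC (shiftC β hβ s) (compShift p β hβ f), coeFn_compShift hβ f] with θ h1 h2 h3 h4
  rw [h1, h2, h3, h4, shiftC_apply]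

lemma compShift_cl (s : C(Torus, ℂ)) : compShift p β hβ (cl p s) = cl p (shiftC β hβ s) := by
  refine Lp.ext ?_
  filter_upwards [coeFn_compShift hβ (cl p s), (quasi_shift β hβ).ae (coeFn_cl (p := p) s),
    coeFn_cl (p := p) (shiftC β hβ s)] with θ h1 h2 h3
  rw [h1, h2, h3, shiftC_apply]

lemma shiftOp_apply (f : LpT p) :
    shiftOp p β hβ f = mulC p (weight β hβ) (compShift p β hβ f) := rfl

lemma shiftC_fourier_natCast (n : ℕ) : shiftC β hβ (fourier n) = alphaC β hβ ^ n := by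
  ext θ
  rw [shiftC_apply, fourier_eq_zpow, pt_shift, zpow_natCast, ContinuousMap.pow_apply]
  rfl

lemma shiftC_fourier_neg_natCast (n : ℕ) : shiftC β hβ (fourier (-n)) = alphaInvC β hβ ^ n := by
  ext θ
  rw [shiftC_apply, fourier_eq_zpow, pt_shift, zpow_neg, zpow_natCast, ContinuousMap.pow_apply,
    ← inv_pow]
  rfl

lemma isAnti_shiftOp_fourier (n : ℕ) : IsAnti (shiftOp p β hβ (cl p (fourier n))) := by
  rw [shiftOp_apply, compShift_cl, shiftC_fourier_natCast, mulC_cl]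
  induction n with
  | zero => rw [pow_zero, mul_one]; exact isAnti_cl_weight hβ
  | succ n ih =>
    have := isAnti_mulC_alphaC hβ ih
    rwa [mulC_cl, mul_left_comm, ← pow_succ'] at this

/-- The factor `α⁻¹` turns the weight into `λ / (t - β)`, which is analytic in the disc, and further
factors `α⁻¹` preserve `H^p`. -/
lemma shiftOp_fourier_mem_hardy (n : ℕ) :
    shiftOp p β hβ (cl p (fourier (-(n + 1 : ℕ)))) ∈ Hardy p := by
  rw [shiftOp_apply, compShift_cl, shiftC_fourier_neg_natCast, mulC_cl]
  induction n with
  | zero => rw [zero_add, pow_one, mul_comm]; exact mulC_alphaInvC_weight_mem_hardy hβ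
  | succ n ih =>
    have := mulC_alphaInvC_mem_hardy hβ ih
    rwa [mulC_cl, mul_left_comm, ← pow_succ'] at this

lemma isAnti_shiftOp (hp1 : 1 < p) (hp : p ≠ ∞) {f : LpT p} (hf : f ∈ Hardy p) :
    IsAnti (shiftOp p β hβ f) := fun n hn => by
  -- Inserting `P` turns the claim into a closed condition on all of `L^p`, which can be checked on
  -- trigonometric polynomials.
  rw [← rieszP_eq_self hp1 hp hf]
  refine (dense_range_cl_trig (p := p) hp).induction_on
    (p := fun f => coeffL p n (shiftOp p β hβ (rieszP p f)) = 0) f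
    (isClosed_eq (by fun_prop) continuous_const) fun c => ?_
  change coeffL p n (shiftOp p β hβ (rieszP p (cl p (trig c)))) = 0
  rw [rieszP_cl_trig hp1 hp]
  induction c using Finsupp.induction_linear with
  | zero => simp
  | add c d hc hd => simp only [map_add, hc, hd, add_zero]
  | single m a =>
    by_cases hm : 0 ≤ m
    · obtain ⟨k, rfl⟩ := Int.eq_ofNat_of_zero_le hm
      have : cut (Finsupp.single (k : ℤ) a) = Finsupp.single (k : ℤ) a :=
        Finsupp.filter_single_of_pos _ hm
      rw [this, trig_single, map_smul, map_smul, map_smul, isAnti_shiftOp_fourier hβ k n hn,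
        smul_zero]
    · have : cut (Finsupp.single m a) = 0 := Finsupp.filter_single_of_neg _ hm
      simp [this]

lemma shiftOp_mem_hardy (hp1 : 1 < p) (hp : p ≠ ∞) {f : LpT p} (hf : IsAnti f) :
    shiftOp p β hβ f ∈ Hardy p := mem_hardy.2 fun n hn => by
  rw [← rieszQ_eq_self hp1 hp hf]
  refine (dense_range_cl_trig (p := p) hp).induction_on
    (p := fun f => coeffL p n (shiftOp p β hβ (rieszQ p f)) = 0) f
    (isClosed_eq (by fun_prop) continuous_const) fun c => ?_
  change coeffL p n (shiftOp p β hβ (rieszQ p (cl p (trig c)))) = 0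
  rw [rieszQ_apply, rieszP_cl_trig hp1 hp, ← map_sub, ← map_sub]
  induction c using Finsupp.induction_linear with
  | zero => simp
  | add c d hc hd => rw [map_add, add_sub_add_comm, map_add, map_add, map_add, map_add, hc, hd,
      add_zero]
  | single m a =>
    by_cases hm : 0 ≤ m
    · have : cut (Finsupp.single m a) = Finsupp.single m a := Finsupp.filter_single_of_pos _ hm
      simp [this]
    · obtain ⟨k, rfl⟩ : ∃ k : ℕ, m = -(k + 1 : ℕ) := ⟨(-1 - m).toNat, by omega⟩
      have : cut (Finsupp.single (-(k + 1 : ℕ) : ℤ) a) = 0 := Finsupp.filter_single_of_neg _ hm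
      rw [this, sub_zero, trig_single, map_smul, map_smul, map_smul,
        mem_hardy.1 (shiftOp_fourier_mem_hardy hβ k) n hn, smul_zero]

end

/-! ## Multiples of an almost nowhere vanishing function -/

section

variable {p : ℝ≥0∞} [Fact (1 ≤ p)]

/-- The measure `|F|^p dm`. -/
def powMeasure (F : LpT p) : Measure Torus := arc.withDensity fun θ => ‖F θ‖ₑ ^ p.toReal

lemma p_ne_zero : p ≠ 0 := (one_pos.trans_le (Fact.out : 1 ≤ p)).ne'

omit [Fact (1 ≤ p)] in
lemma measurable_coe (F : LpT p) : Measurable F := (Lp.stronglyMeasurable F).measurable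

lemma eLpNorm_powMeasure (hp : p ≠ ∞) (F : LpT p) {g : Torus → ℂ} (hg : Measurable g) :
    eLpNorm g p (powMeasure F) = eLpNorm (fun θ => g θ * F θ) p arc := by
  rw [eLpNorm_eq_lintegral_rpow_enorm_toReal p_ne_zero hp,
    eLpNorm_eq_lintegral_rpow_enorm_toReal p_ne_zero hp, powMeasure,
    lintegral_withDensity_eq_lintegral_mul arc ((measurable_coe F).enorm.pow_const _)
      (hg.enorm.pow_const _)]
  congr 1
  refine lintegral_congr fun θ => ?_
  rw [Pi.mul_apply, enorm_mul, ENNReal.mul_rpow_of_nonneg _ _ ENNReal.toReal_nonneg, mul_comm]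

lemma isFiniteMeasure_powMeasure (hp : p ≠ ∞) (F : LpT p) : IsFiniteMeasure (powMeasure F) := by
  refine isFiniteMeasure_withDensity ?_
  have h := (Lp.memLp F).2
  exact (lintegral_rpow_enorm_lt_top_of_eLpNorm_lt_top p_ne_zero hp h).ne

/-- Since `F ≠ 0` almost everywhere, `x ↦ x / F` carries `L^p` isometrically into `L^p(|F|^p dm)`, a
finite measure space in which continuous functions are dense. -/
lemma dense_range_mulC (hp : p ≠ ∞) {F : LpT p} (hF : ∀ᵐ θ ∂arc, F θ ≠ 0) :
    DenseRange fun s : C(Torus, ℂ) => mulC p s F := by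
  intro x
  have := isFiniteMeasure_powMeasure hp F
  rw [Metric.mem_closure_iff]
  intro ε hε
  have hgm : Measurable fun θ => x θ / F θ := (measurable_coe x).div (measurable_coe F)
  have hgF : (fun θ => x θ / F θ * F θ) =ᵐ[arc] x := by
    filter_upwards [hF] with θ hθ
    rw [div_mul_cancel₀ _ hθ]
  have hg : MemLp (fun θ => x θ / F θ) p (powMeasure F) := by
    refine ⟨hgm.aestronglyMeasurable, ?_⟩
    rw [eLpNorm_powMeasure hp F hgm, eLpNorm_congr_ae hgF]
    exact (Lp.memLp x).2
  obtain ⟨s, hs, -⟩ := hg.exists_boundedContinuous_eLpNorm_sub_le hp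
    (ε := ENNReal.ofReal (ε / 2)) (by simpa using hε)
  refine ⟨_, ⟨s.toContinuousMap, rfl⟩, ?_⟩
  have hsm : Measurable ((fun θ => x θ / F θ) - ⇑s) := hgm.sub s.continuous.measurable
  rw [eLpNorm_powMeasure hp F hsm] at hs
  have hae : (fun θ => ((fun θ => x θ / F θ) - ⇑s) θ * F θ) =ᵐ[arc]
      ⇑(x - mulC p s.toContinuousMap F) := by
    filter_upwards [hgF, Lp.coeFn_sub x (mulC p s.toContinuousMap F),
      coeFn_mulC s.toContinuousMap F] with θ h1 h2 h3
    rw [h2, Pi.sub_apply, Pi.sub_apply, h3, sub_mul]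
    change x θ / F θ * F θ = x θ at h1
    rw [h1]
    rfl
  rw [eLpNorm_congr_ae hae] at hs
  rw [dist_eq_norm, Lp.norm_def]
  refine lt_of_le_of_lt (ENNReal.toReal_mono ENNReal.ofReal_ne_top hs) ?_
  rw [ENNReal.toReal_ofReal (by positivity)]
  linarith

/-! ## Coburn's theorem for operators `φ ↦ P a (I + U) φ` -/

lemma eq_zero_of_eq_neg {x : LpT p} (h : x = -x) : x = 0 := ext_coeff fun n => by
  have h1 := congrArg (coeffL p n) h
  rw [map_neg] at h1
  rw [map_zero]
  exact self_eq_neg.1 h1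

lemma rieszPH_coe (x : LpT p) : ((rieszPH p x : Hardy p) : LpT p) = rieszP p x := rfl

lemma mulOp_eq_zero {a : Linf} (ha : IsGLinf a) {g : LpT p} (h : mulOp p a g = 0) : g = 0 := by
  obtain ⟨b, hb⟩ := ha
  refine (Lp.eq_zero_iff_ae_eq_zero).2 ?_
  have h' := (Lp.eq_zero_iff_ae_eq_zero).1 h
  filter_upwards [hb, h', coeFn_mulOp a g] with θ h1 h2 h3
  rw [h3] at h2
  have h4 : a θ ≠ 0 := fun h0 => by rw [h0, zero_mul] at h1; exact zero_ne_one h1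
  exact (mul_eq_zero.1 h2).resolve_left h4

variable {β : ℂ} (hβ : 1 < ‖β‖)

/-- A version of Coburn's theorem: `U φ = u (φ ∘ α)` is an involution such that `I + U` maps `H^p`
bijectively onto the fixed space of `U`. -/
theorem kerOrCokerTrivial_of_involution (hp1 : 1 < p) (hp : p ≠ ∞) {a : Linf} (ha : IsGLinf a)
    {U : LpT p →L[ℂ] LpT p} {u : C(Torus, ℂ)} (hU : ∀ f, U f = mulC p u (compShift p β hβ f))
    (hUU : ∀ f, U (U f) = f) (inj : ∀ f ∈ Hardy p, f + U f = 0 → f = 0)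
    (surj : ∀ g, U g = g → ∃ f ∈ Hardy p, f + U f = g) {A : Hardy p →L[ℂ] Hardy p}
    (hA : ∀ f : Hardy p, (A f : LpT p) = rieszP p (mulOp p a (f + U f))) :
    KerOrCokerTrivial A := by
  refine or_iff_not_imp_left.2 fun hker => ?_
  obtain ⟨f, hf, hf0⟩ := (Submodule.ne_bot_iff _).1 hker
  have hAf : A f = 0 := hf
  refine (Submodule.eq_bot_iff _).2 fun ℓ hℓ => ?_
  have hℓA : ∀ x, ℓ (A x) = 0 := fun x => by
    have h : bAdjoint A ℓ = 0 := hℓ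
    exact DFunLike.congr_fun h x
  set g : LpT p := f + U f with hg
  have hUg : U g = g := by rw [hg, map_add, hUU, add_comm]
  set F : LpT p := mulOp p a g with hF
  have hFa : IsAnti F := (rieszP_eq_zero_iff hp1 hp).1 (by
    rw [hF, hg, ← hA, hAf]; rfl)
  have hF0 : F ≠ 0 := fun h =>
    hf0 (Subtype.ext (inj f f.2 (mulOp_eq_zero ha h)))
  have hFne := ae_ne_zero_of_coeff hp1 hp hFa hF0
  set L : LpT p →L[ℂ] ℂ := ℓ ∘L rieszPH p with hL
  have hLa : ∀ x, IsAnti x → L x = 0 := fun x hx => by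
    have : rieszPH p x = 0 := Subtype.ext ((rieszP_eq_zero_iff hp1 hp).2 hx)
    rw [hL, ContinuousLinearMap.comp_apply, this, map_zero]
  -- Multiplication by an `α`-invariant `s` commutes with `U`, so `s g` is again a fixed point.
  have heven : ∀ s : C(Torus, ℂ), shiftC β hβ s = s → L (mulC p s F) = 0 := fun s hs => by
    obtain ⟨x, hx, hxg⟩ := surj (mulC p s g) (by
      rw [hU, compShift_mulC, hs, mulC_mulC, mul_comm, ← mulC_mulC, ← hU, hUg])
    have h : rieszPH p (mulC p s F) = A ⟨x, hx⟩ := Subtype.ext (by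
      rw [rieszPH_coe, hA, hF, mulC_mulOp, hxg])
    rw [hL, ContinuousLinearMap.comp_apply, h, hℓA]
  -- For `n > 0` the function `tⁿ` is completed to the `α`-invariant `tⁿ + αⁿ`; the added term
  -- contributes nothing because `αⁿ F ∈ ker P`.
  have hfour : ∀ n : ℤ, L (mulC p (fourier n) F) = 0 := fun n => by
    rcases le_or_gt n 0 with hn | hn
    · exact hLa _ fun m hm => by rw [coeffL_mulC_fourier, hFa _ (by omega)]
    · obtain ⟨k, rfl⟩ := Int.eq_ofNat_of_zero_le hn.le
      have h1 : L (mulC p (shiftC β hβ (fourier (k : ℤ))) F) = 0 := by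
        refine hLa _ ?_
        rw [shiftC_fourier_natCast]
        clear hn
        induction k with
        | zero => rwa [pow_zero, mulC_one]
        | succ k ih => rw [pow_succ', ← mulC_mulC]; exact isAnti_mulC_alphaC hβ ih
      have h2 := heven (fourier (k : ℤ) + shiftC β hβ (fourier (k : ℤ))) (by
        have : ∀ s t : C(Torus, ℂ), shiftC β hβ (s + t) = shiftC β hβ s + shiftC β hβ t :=
          fun s t => rfl
        rw [this, shiftC_shiftC, add_comm])
      rwa [mulC_add, map_add, h1, add_zero] at h2
  have hall : ∀ s : C(Torus, ℂ), L (mulC p s F) = 0 := fun s => by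
    refine dense_range_trig.induction_on (p := fun s => L (mulC p s F) = 0) s
      (isClosed_eq (L.continuous.comp (continuous_mulC F)) continuous_const) fun c => ?_
    induction c using Finsupp.induction_linear with
    | zero =>
      have := mulC_smul (p := p) 0 1 F
      rw [zero_smul ℂ (1 : C(Torus, ℂ)), zero_smul] at this
      rw [map_zero, this, map_zero]
    | add c d hc hd => rw [map_add, mulC_add, map_add, hc, hd, add_zero]
    | single n c => rw [trig_single, mulC_smul, map_smul, hfour, smul_zero]
  have hL0 : ∀ x, L x = 0 := fun x =>
    (dense_range_mulC hp hFne).induction_on (p := fun x => L x = 0) x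
      (isClosed_eq L.continuous continuous_const) hall
  ext x
  have hx : rieszPH p (x : LpT p) = x := Subtype.ext (rieszP_eq_self hp1 hp x.2)
  have := hL0 x
  rwa [hL, ContinuousLinearMap.comp_apply, hx] at this

/-! ## The four involutions -/

include hβ

/-- This is what the normalization of `λ` is for: `(β̄ t - 1)(β̄ α(t) - 1) = 1 - |β|² = λ²`. It
makes `J_α` an involution. -/
lemma weight_mul_shiftC_weight : weight β hβ * shiftC β hβ (weight β hβ) = 1 := by
  ext θ
  have h0 := den_ne_zero hβ (norm_pt θ)
  have hl : lam β * lam β = 1 - β * conj β := by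
    have hb : (0 : ℝ) ≤ ‖β‖ ^ 2 - 1 := by nlinarith
    have h1 : ((Real.sqrt (‖β‖ ^ 2 - 1) : ℝ) : ℂ) * (Real.sqrt (‖β‖ ^ 2 - 1) : ℝ) =
        β * conj β - 1 := by
      rw [← ofReal_mul, Real.mul_self_sqrt hb, mul_conj, normSq_eq_norm_sq]
      push_cast
      ring
    rw [lam]
    linear_combination I * I * h1 + (β * conj β - 1) * I_mul_I
  have h1 : (conj β * pt θ - 1) * (conj β * alpha β (pt θ) - 1) = lam β * lam β := by
    rw [hl, alpha]
    field_simp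
    ring
  have h2 : lam β ≠ 0 := lam_ne_zero hβ
  rw [ContinuousMap.mul_apply, shiftC_apply, weight_apply, weight_apply, pt_shift,
    div_mul_div_comm, h1, div_self (mul_ne_zero h2 h2), ContinuousMap.one_apply]

lemma shiftOp_mulC_weight (f : LpT p) :
    shiftOp p β hβ (mulC p (weight β hβ) f) = compShift p β hβ f := by
  rw [shiftOp_apply, compShift_mulC, mulC_mulC, weight_mul_shiftC_weight, mulC_one]

lemma shiftOp_shiftOp (f : LpT p) : shiftOp p β hβ (shiftOp p β hβ f) = f := by
  rw [shiftOp_apply hβ f, shiftOp_mulC_weight, compShift_compShift]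

lemma chi_mul_weight : chi β hβ * weight β hβ = 1 := by
  ext θ
  have h1 := pt_ne_zero θ
  have h2 := alphaMinus_ne_zero β hβ (norm_pt θ)
  change pt θ / alphaMinus β (pt θ) * ((pt θ)⁻¹ * alphaMinus β (pt θ)) = 1
  field_simp

lemma chiInv_eq_weight : chiInv β hβ = weight β hβ := by
  ext θ
  change (pt θ / alphaMinus β (pt θ))⁻¹ = (pt θ)⁻¹ * alphaMinus β (pt θ)
  rw [inv_div, div_eq_mul_inv, mul_comm]

lemma chi_eq_lin : chi β hβ = lin (conj β / lam β) (-1 / lam β) := by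
  ext θ
  have h1 := pt_ne_zero θ
  have h2 := lam_ne_zero hβ
  have h0 := den_ne_zero hβ (norm_pt θ)
  rw [lin_apply]
  change pt θ / (lam β * pt θ / (conj β * pt θ - 1)) = _
  field_simp
  ring

lemma mulC_chi_shiftOp (f : LpT p) :
    mulC p (chi β hβ) (shiftOp p β hβ f) = compShift p β hβ f := by
  rw [shiftOp_apply, mulC_mulC, chi_mul_weight, mulC_one]

lemma coeffL_mulC_chi_of_isAnti {f : LpT p} (hf : IsAnti f) {n : ℤ} (hn : 0 < n) :
    coeffL p n (mulC p (chi β hβ) f) = 0 := by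
  rw [chi_eq_lin, coeffL_mulC_lin, hf n hn.le, hf (n - 1) (by omega)]
  simp

/-- Such an `x` is constant. This handles the single frequency `0` in which `χ^{±1} J_α` differs
from a perfect exchange of `H^p` and `ker P`. -/
lemma compShift_eq_self {x : LpT p} (hx : ∀ n ≠ 0, coeffL p n x = 0) : compShift p β hβ x = x := by
  have h : x = cl p (coeffL p 0 x • 1) := ext_coeff fun n => by
    rw [coeffL_const]
    split_ifs with hn
    · rw [hn]
    · exact hx n hn
  rw [h, compShift_cl]
  rfl

lemma hankel_coe (hp1 : 1 < p) (hp : p ≠ ∞) (b : Linf) (f : Hardy p) :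
    ((hankel p β hβ b f : Hardy p) : LpT p) = rieszP p (mulOp p b (shiftOp p β hβ f)) := by
  change rieszP p (mulOp p b (rieszQ p (shiftOp p β hβ f))) = _
  rw [rieszQ_eq_self hp1 hp (isAnti_shiftOp hβ hp1 hp f.2)]

omit hβ in
lemma toeplitz_coe (a : Linf) (f : Hardy p) :
    ((toeplitz p a f : Hardy p) : LpT p) = rieszP p (mulOp p a f) := rfl

omit hβ in
-- With `f = (P g + U Q g) / 2`, the sum `f + U f` is `(g + U g) / 2 = g`.
lemma exists_add_eq_of_mem_hardy (hp1 : 1 < p) (hp : p ≠ ∞) {U : LpT p →L[ℂ] LpT p}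
    (hUU : ∀ f, U (U f) = f) (hUQ : ∀ f, IsAnti f → U f ∈ Hardy p) (g : LpT p) (hg : U g = g) :
    ∃ f ∈ Hardy p, f + U f = g := by
  refine ⟨(1 / 2 : ℂ) • (rieszP p g + U (rieszQ p g)), (Hardy p).smul_mem _
    ((Hardy p).add_mem (rieszP_mem p g) (hUQ _ (isAnti_rieszQ hp1 hp g))), ?_⟩
  have h : U (rieszP p g) + U (rieszQ p g) = g := by
    rw [← map_add, rieszQ_apply, add_sub_cancel, hg]
  rw [map_smul, map_add, hUU, ← smul_add]
  have e : rieszP p g + U (rieszQ p g) + (U (rieszP p g) + rieszQ p g) = (2 : ℂ) • g := by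
    rw [two_smul]
    nth_rewrite 5 [← h]
    rw [rieszQ_apply]
    abel
  rw [e, smul_smul]
  norm_num

lemma eq_zero_of_add_shiftOp (hp1 : 1 < p) (hp : p ≠ ∞) (σ : ℂ) {f : LpT p} (hf : f ∈ Hardy p)
    (h : f + σ • shiftOp p β hβ f = 0) : f = 0 := by
  refine eq_zero_of_isAnti_of_mem ?_ hf
  rw [eq_neg_of_add_eq_zero_left h]
  exact ((isAnti_shiftOp hβ hp1 hp hf).smul σ).neg

theorem kerOrCokerTrivial_smul_hankel (hp1 : 1 < p) (hp : p ≠ ∞) {a : Linf} (ha : IsGLinf a)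
    {σ : ℂ} (hσ : σ * σ = 1) : KerOrCokerTrivial (toeplitz p a + σ • hankel p β hβ a) := by
  have hUU : ∀ f, (σ • shiftOp p β hβ) ((σ • shiftOp p β hβ) f) = f := fun f => by
    simp only [smul_apply, map_smul, shiftOp_shiftOp, smul_smul, hσ, one_smul]
  refine kerOrCokerTrivial_of_involution hβ hp1 hp ha (U := σ • shiftOp p β hβ)
    (u := σ • weight β hβ) (fun f => ?_) hUU (fun f hf h => ?_) (fun g hg => ?_) (fun f => ?_)
  · rw [mulC_smul]; rfl
  · exact eq_zero_of_add_shiftOp hβ hp1 hp σ hf h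
  · exact exists_add_eq_of_mem_hardy hp1 hp hUU
      (fun f hf => (Hardy p).smul_mem _ (shiftOp_mem_hardy hβ hp1 hp hf)) g hg
  · rw [map_add, map_add, ← toeplitz_coe, smul_apply, map_smul, map_smul, ← hankel_coe hβ hp1 hp]
    rfl

/-- Here `U` is composition with `α`. It sends `H^p` only into functions with spectrum in `n ≤ 0`,
so `f = -U f` leaves a constant `f`; then `U f = f` forces `f = 0`. With the opposite sign,
constants would survive. -/
theorem kerOrCokerTrivial_add_hankel_chi (hp1 : 1 < p) (hp : p ≠ ∞) {a : Linf} (ha : IsGLinf a) :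
    KerOrCokerTrivial (toeplitz p a + hankel p β hβ (mulInf a (ofCont (chi β hβ)))) := by
  refine kerOrCokerTrivial_of_involution hβ hp1 hp ha (U := compShift p β hβ)
    (u := 1) (fun f => (mulC_one _).symm) (compShift_compShift hβ) (fun f hf h => ?_)
    (exists_add_eq_of_mem_hardy hp1 hp (compShift_compShift hβ) fun f hf => ?_) (fun f => ?_)
  · have h1 : f = -compShift p β hβ f := eq_neg_of_add_eq_zero_left h
    have h2 : compShift p β hβ f = f := compShift_eq_self hβ fun n hn => by
      rcases lt_or_gt_of_ne hn with hn | hn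
      · exact mem_hardy.1 hf n hn
      · rw [h1, map_neg, ← mulC_chi_shiftOp,
          coeffL_mulC_chi_of_isAnti hβ (isAnti_shiftOp hβ hp1 hp hf) hn, neg_zero]
    rw [h2] at h1
    exact eq_zero_of_eq_neg h1
  · rw [← mulC_chi_shiftOp, chi_eq_lin]
    exact mulC_lin_mem_hardy _ _ (shiftOp_mem_hardy hβ hp1 hp hf)
  · rw [map_add, map_add, ← toeplitz_coe, ← mulC_chi_shiftOp, ← mulOp_mulInf,
      ← hankel_coe hβ hp1 hp]
    rfl

/-- Here `U` sends `H^p` into `ker P`, which gives injectivity, but it need not send `ker P` into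
`H^p`. Surjectivity therefore needs its own argument, with preimage `P g`. -/
theorem kerOrCokerTrivial_sub_hankel_chiInv (hp1 : 1 < p) (hp : p ≠ ∞) {a : Linf}
    (ha : IsGLinf a) :
    KerOrCokerTrivial (toeplitz p a - hankel p β hβ (mulInf a (ofCont (chiInv β hβ)))) := by
  rw [chiInv_eq_weight]
  set U : LpT p →L[ℂ] LpT p := -(mulC p (weight β hβ) ∘L shiftOp p β hβ) with hU
  have hUf : ∀ f, U f = -mulC p (weight β hβ) (shiftOp p β hβ f) := fun f => rfl
  have hUU : ∀ f, U (U f) = f := fun f => by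
    rw [hUf, hUf, map_neg, map_neg, neg_neg, shiftOp_mulC_weight, ← shiftOp_apply, shiftOp_shiftOp]
  have hUanti : ∀ f ∈ Hardy p, IsAnti (U f) := fun f hf => by
    rw [hUf]
    exact (isAnti_mulC_weight hβ (isAnti_shiftOp hβ hp1 hp hf)).neg
  refine kerOrCokerTrivial_of_involution hβ hp1 hp ha (U := U)
    (u := (-1 : ℂ) • (weight β hβ * weight β hβ)) (fun f => ?_) hUU (fun f hf h => ?_)
    (fun g hg => ?_) (fun f => ?_)
  · rw [mulC_smul, neg_one_smul, hUf, ← mulC_mulC, shiftOp_apply]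
  · refine eq_zero_of_isAnti_of_mem ?_ hf
    rw [eq_neg_of_add_eq_zero_left h]
    exact (hUanti f hf).neg
  · refine ⟨rieszP p g, rieszP_mem p g, ?_⟩
    -- The defect `r` lies in `ker P` and is fixed by `U`. Then `χ r = -J_α r` has spectrum in both
    -- `n ≤ 0` and `n ≥ 0`, so it is a constant `x`; since `r = χ⁻¹ x` and `J_α (χ⁻¹ x) = x ∘ α =
    -- x`, it follows that `x = -x`.
    set r := g - (rieszP p g + U (rieszP p g)) with hr
    have hra : IsAnti r := by
      have e : r = rieszQ p g + -U (rieszP p g) := by rw [hr, rieszQ_apply]; abel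
      rw [e]
      exact (isAnti_rieszQ hp1 hp g).add (hUanti _ (rieszP_mem p g)).neg
    have hUr : U r = r := by
      rw [hr, map_sub, map_add, hUU, hg, add_comm]
    set x := mulC p (chi β hβ) r with hx
    have hx1 : x = -shiftOp p β hβ r := by
      rw [hx, ← hUr, hUf, map_neg, mulC_mulC, chi_mul_weight, mulC_one, ← hUf, hUr]
    have hx2 : compShift p β hβ x = x := compShift_eq_self hβ fun n hn => by
      rcases lt_or_gt_of_ne hn with hn | hn
      · rw [hx1, map_neg, mem_hardy.1 (shiftOp_mem_hardy hβ hp1 hp hra) n hn, neg_zero]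
      · exact coeffL_mulC_chi_of_isAnti hβ hra hn
    have hx3 : r = mulC p (weight β hβ) x := by
      rw [hx, mulC_mulC, mul_comm, chi_mul_weight, mulC_one]
    have hx4 : x = -x := by
      conv_lhs => rw [hx1, hx3, shiftOp_mulC_weight, hx2]
    have hr0 : r = 0 := by rw [hx3, eq_zero_of_eq_neg hx4, map_zero]
    exact (sub_eq_zero.1 hr0).symm
  · rw [map_add, map_add, ← toeplitz_coe, hUf, map_neg, map_neg, ← mulOp_mulInf,
      ← hankel_coe hβ hp1 hp, ← sub_eq_add_neg]
    rfl

end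

end GenHankel

end

theorem theorem3p2 (β : ℂ) (hβ : 1 < ‖β‖) (p : ℝ≥0∞) [Fact (1 ≤ p)] (hp1 : 1 < p) (hp : p < ∞)
    (a : Linf) (ha : IsGLinf a) :
    KerOrCokerTrivial (toeplitz p a - hankel p β hβ (mulInf a (ofCont (chiInv β hβ)))) ∧
    KerOrCokerTrivial (toeplitz p a + hankel p β hβ (mulInf a (ofCont (chi β hβ)))) ∧
    KerOrCokerTrivial (toeplitz p a + hankel p β hβ a) ∧
    KerOrCokerTrivial (toeplitz p a - hankel p β hβ a) := by
  refine ⟨kerOrCokerTrivial_sub_hankel_chiInv hβ hp1 hp.ne ha,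
    kerOrCokerTrivial_add_hankel_chi hβ hp1 hp.ne ha, ?_, ?_⟩
  · have h := kerOrCokerTrivial_smul_hankel hβ hp1 hp.ne ha (σ := 1) (one_mul 1)
    rwa [one_smul] at h
  · have h := kerOrCokerTrivial_smul_hankel hβ hp1 hp.ne ha (σ := -1) (by ring)
    have e : toeplitz p a + (-1 : ℂ) • hankel p β hβ a = toeplitz p a - hankel p β hβ a :=
      ContinuousLinearMap.ext fun f => by
        rw [add_apply, sub_apply, smul_apply, neg_one_smul, sub_eq_add_neg]
    rwa [e] at h
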